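/- **Setting.** Let $\mathcal G$ be a connected undirected graph on the agents $\{1,\dots,m\}$ with Laplacian $L$ ($L_{ii}$ = number of neighbours of $i$, $L_{ij}=-1$ if $i\ne j$ are adjacent, $0$ otherwise), and put $\mathbf L=L\otimes I_d$, acting on stacked vectors $\mathbf x=(x_1,\dots,x_m)\in\mathbb R^{md}$. For each $i$ let $X_i\subset\mathbb R^d$ be compact and convex, let $\|\cdot\|_{X_i}$ be a norm on $\mathbb R^d$ with dual norm $\|g\|_{X_i,*}=\sup\{\langle g,x\rangle:\|x\|_{X_i}\le1\}$, and let $\omega_i:X_i\to\mathbb R$ be continuously differentiable with $\langle\nabla\omega_i(x)-\nabla\omega_i(u),x-u\rangle\ge\|x-u\|_{X_i}^2$ for $x,u\in X_i$. Put $V_i(x,u)=\omega_i(u)-\omega_i(x)-\langle\nabla\omega_i(x),u-x\rangle$, $X^m=X_1\times\dots\times X_m$, $\mathbf V(\mathbf x,\mathbf u)=\sum_iV_i(x_i,u_i)$, $\|\mathbf x\|_{X^m}^2=\sum_i\|x_i\|_{X_i}^2$ and $\|\mathbf L\|=\sup\{\|\mathbf L\mathbf x\|_2:\|\mathbf x\|_{X^m}\le1\}$.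 Let $f_i:X_i\to\mathbb R$ be convex and let $f_i'(y)$, $y\in X_i$, be subgradients such that, for a constant $M>0$, $$0\le f_i(x)-f_i(y)-\langle f_i'(y),x-y\rangle\le M\|x-y\|_{X_i}\qquad(x,y\in X_i).$$ Let $F(\mathbf x)=\sum_if_i(x_i)$, and let $\mathbf x^*$ minimize $F$ over $\{\mathbf x\in X^m:\mathbf L\mathbf x=\mathbf 0\}$. Put $\bar{\mathbf V}(\mathbf x^*)=\sum_i\max_{x_i\in X_i}V_i(x_i^*,x_i)$ and, for $\mathbf v\in\mathbb R^{md}$ and $\mathbf z=(\mathbf x,\mathbf y)\in X^m\times\mathbb R^{md}$, $$g(\mathbf v,\mathbf z)=\sup_{\bar{\mathbf y}\in\mathbb R^{md}}\Big\{F(\mathbf x)+\langle\mathbf L\mathbf x,\bar{\mathbf y}\rangle-F(\mathbf x^*)-\langle\mathbf L\mathbf x^*,\mathbf y\rangle-\langle\mathbf v,\bar{\mathbf y}\rangle\Big\}\in[-\infty,\infty].$$ **Oracle.** Let $\xi_i^{t,k}$ ($1\le i\le m$, $t\ge0$, $k\ge0$) be mutually independent random variables, $\sigma>0$, and let $G_i(u,\xi)$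 be jointly measurable such that for all $i,t,k$ and $u\in X_i$ $$\mathbb E[G_i(u,\xi_i^{t,k})]=f_i'(u),\quad \mathbb E\|G_i(u,\xi_i^{t,k})-f_i'(u)\|_{X_i,*}^2\le\sigma^2,\quad \mathbb E\exp\{\|G_i(u,\xi_i^{t,k})-f_i'(u)\|_{X_i,*}^2/\sigma^2\}\le e .$$ **Algorithm (SDCS).** Let $N\ge1$, $\mathbf x^0=\mathbf x^{-1}=\hat{\mathbf x}^0\in X^m$, $\mathbf y^0\in\mathbb R^{md}$. For $k=1,\dots,N$ put $\tilde{\mathbf x}^k=\alpha_k(\hat{\mathbf x}^{k-1}-\mathbf x^{k-2})+\mathbf x^{k-1}$, $\mathbf v^k=\mathbf L\tilde{\mathbf x}^k$, $\mathbf y^k=\mathbf y^{k-1}+\tau_k^{-1}\mathbf v^k$, $\mathbf w^k=\mathbf L\mathbf y^k$; then, for every agent $i$, start from $u_i^{0,k}=x_i^{k-1}$ and for $t=1,\dots,T_k$ let $$u_i^{t,k}=\operatorname*{argmin}_{u\in X_i}\big[\langle w_i^k+G_i(u_i^{t-1,k},\xi_i^{t-1,k}),u\rangle+\eta_kV_i(x_i^{k-1},u)+\eta_k\beta_tV_i(u_i^{t-1,k},u)\big],$$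 and set $x_i^k=u_i^{T_k,k}$, $\hat x_i^k=\big(\sum_{t=1}^{T_k}\lambda_t\big)^{-1}\sum_{t=1}^{T_k}\lambda_tu_i^{t,k}$. Put $$\hat{\mathbf z}^N=\Big(\sum_{k=1}^N\theta_k\Big)^{-1}\sum_{k=1}^N\theta_k(\hat{\mathbf x}^k,\mathbf y^k),\qquad \hat{\mathbf v}^N=\Big(\sum_{k=1}^N\theta_k\Big)^{-1}\big[\theta_N\mathbf L(\hat{\mathbf x}^N-\mathbf x^{N-1})+\theta_1\tau_1(\mathbf y^N-\mathbf y^0)\big],$$ where in $\hat{\mathbf v}^N$ the symbol $\hat{\mathbf x}^N$ denotes the last iterate. **Parameters.** Let $\lambda_t=t+1$, $\beta_t=t/2$ for $t\ge1$; for $k=1,\dots,N$ let $\alpha_k\ge0$, $\theta_k,\eta_k,\tau_k>0$ and let $T_k\ge1$ be an integer; for $k=2,\dots,N$ let $$\alpha_k\theta_k=\theta_{k-1},\quad \theta_k\tau_k\le\theta_{k-1}\tau_{k-1},\quad \alpha_k\|\mathbf L\|^2\le\eta_{k-1}\tau_k,\quad \theta_k\tfrac{(T_k+1)(T_k+2)\eta_k}{T_k(T_k+3)}\le\theta_{k-1}\tfrac{(T_{k-1}+1)(T_{k-1}+2)\eta_{k-1}}{T_{k-1}(T_{k-1}+3)},$$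 and let $\theta_1\tau_1=\theta_N\tau_N$ and $\theta_N\|\mathbf L\|^2\le\theta_1\tau_1\eta_N$. **Theorem.** For every $\zeta>0$, $$\mathrm{Prob}\big\{g(\hat{\mathbf v}^N,\hat{\mathbf z}^N)\ge\mathcal B_d(N)+\zeta\,\mathcal B_p(N)\big\}\le e^{-\zeta^2/3}+e^{-\zeta},$$ where $$\mathcal B_d(N)=\Big(\sum_{k=1}^N\theta_k\Big)^{-1}\Big[\tfrac{(T_1+1)(T_1+2)\theta_1\eta_1}{T_1(T_1+3)}\mathbf V(\mathbf x^0,\mathbf x^*)+\tfrac{\theta_1\tau_1}2\|\mathbf y^0\|_2^2+\sum_{k=1}^N\tfrac{8m(M^2+\sigma^2)\theta_k}{\eta_k(T_k+3)}\Big],$$ $$\mathcal B_p(N)=\Big(\sum_{k=1}^N\theta_k\Big)^{-1}\Big\{\sigma\Big[2\bar{\mathbf V}(\mathbf x^*)\sum_{k=1}^N\sum_{t=1}^{T_k}\Big(\tfrac{\theta_k\lambda_t}{\sum_{s=1}^{T_k}\lambda_s}\Big)^2\Big]^{1/2}+\sum_{k=1}^N\sum_{t=1}^{T_k}\sum_{i=1}^m\tfrac{\sigma^2\theta_k\lambda_t}{(\sum_{s=1}^{T_k}\lambda_s)\eta_k\beta_t}\Big\}.$$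 -/

import Mathlib

open MeasureTheory ProbabilityTheory
open scoped RealInnerProductSpace

noncomputable section

namespace SDCS

/-- The decision space `ℝ^d` of one agent, with its standard inner product. -/
abbrev Vec (d : ℕ) : Type := EuclideanSpace ℝ (Fin d)

/-- Stacked vectors `(x_1, …, x_m) ∈ ℝ^{md}`, with the standard Euclidean inner product and norm. -/
abbrev Stack (m d : ℕ) : Type := PiLp 2 (fun _ : Fin m => Vec d)

/-! ### Norms, the Laplacian -/

/-- The dual norm `‖g‖_* = sup {⟨g, x⟩ : ‖x‖ ≤ 1}` of a norm `p` on `ℝ^d`. -/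
def dualNorm {d : ℕ} (p : Seminorm ℝ (Vec d)) (g : Vec d) : ℝ :=
  sSup ((fun x : Vec d => ⟪g, x⟫) '' {x | p x ≤ 1})

/-- The primal norm `‖x‖² = ∑ i, ‖x_i‖²_{X_i}` on stacked vectors. -/
def primalNorm {m d : ℕ} (p : Fin m → Seminorm ℝ (Vec d)) (x : Stack m d) : ℝ :=
  Real.sqrt (∑ i, (p i (x i)) ^ 2)

/-- The operator `𝐋 = L ⊗ I_d`, where `L` is the Laplacian of the graph. Since `L i j = 0` unless
`j` is `i` or a neighbour of `i`, the sum runs effectively over the closed neighbourhood of `i`. -/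
def lapOp {m : ℕ} (d : ℕ) (G : SimpleGraph (Fin m)) [DecidableRel G.Adj] (x : Stack m d) :
    Stack m d :=
  WithLp.toLp 2 (fun i => ∑ j, G.lapMatrix ℝ i j • x j)

/-- The operator norm of `𝐋` from the primal norm to the Euclidean norm:
the least constant with `⟨𝐋 x, y⟩ ≤ ‖𝐋‖ ‖x‖ ‖y‖₂`. -/
def lapNorm {m d : ℕ} (G : SimpleGraph (Fin m)) [DecidableRel G.Adj]
    (p : Fin m → Seminorm ℝ (Vec d)) : ℝ :=
  sSup ((fun x : Stack m d => ‖lapOp d G x‖) '' {x | primalNorm p x ≤ 1})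

/-! ### Distance generating functions and prox-functions -/

/-- `ω` is a distance generating function on `U` with modulus `ν` with respect to the norm `p`,
and `gradω` is its gradient on `U`. -/
structure IsDistGen {d : ℕ} (p : Seminorm ℝ (Vec d)) (U : Set (Vec d)) (ν : ℝ)
    (ω : Vec d → ℝ) (gradω : Vec d → Vec d) : Prop where
  hasGradient : ∀ x ∈ U, HasGradientWithinAt ω (gradω x) U x
  continuous_grad : ContinuousOn gradω U
  strong : ∀ x ∈ U, ∀ u ∈ U, ν * (p (x - u)) ^ 2 ≤ ⟪gradω x - gradω u, x - u⟫

/-- The prox-function (Bregman distance) `V(x, u) = ω(u) - [ω(x) + ⟨∇ω(x), u - x⟩]`. -/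
def prox {d : ℕ} (ω : Vec d → ℝ) (gradω : Vec d → Vec d) (x u : Vec d) : ℝ :=
  ω u - (ω x + ⟪gradω x, u - x⟫)

/-- `𝐕(x, u) = ∑ i, V_i(x_i, u_i)`. -/
def stackProx {m d : ℕ} (ω : Fin m → Vec d → ℝ) (gradω : Fin m → Vec d → Vec d)
    (x u : Stack m d) : ℝ :=
  ∑ i, prox (ω i) (gradω i) (x i) (u i)

/-- `∑ i, max_{x_i ∈ X_i} V_i(x*_i, x_i)`. -/
def maxProx {m d : ℕ} (X : Fin m → Set (Vec d)) (ω : Fin m → Vec d → ℝ)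
    (gradω : Fin m → Vec d → Vec d) (xs : Stack m d) : ℝ :=
  ∑ i, sSup (prox (ω i) (gradω i) (xs i) '' X i)

/-! ### The problem and the gap functions -/

/-- `F(x) = ∑ i, f_i(x_i)`. -/
def objective {m d : ℕ} (f : Fin m → Vec d → ℝ) (x : Stack m d) : ℝ := ∑ i, f i (x i)

/-- `{x ∈ X_1 × ⋯ × X_m : 𝐋 x = 0}`. -/
def feasibleSet {m d : ℕ} (G : SimpleGraph (Fin m)) [DecidableRel G.Adj]
    (X : Fin m → Set (Vec d)) : Set (Stack m d) :=
  {x | lapOp d G x = 0 ∧ ∀ i, x i ∈ X i}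

/-- The primal-dual gap function
`Q(x, y; x̄, ȳ) = F(x) + ⟨𝐋x, ȳ⟩ - [F(x̄) + ⟨𝐋x̄, y⟩]`. -/
def gapQ {m d : ℕ} (G : SimpleGraph (Fin m)) [DecidableRel G.Adj] (f : Fin m → Vec d → ℝ)
    (x y xbar ybar : Stack m d) : ℝ :=
  objective f x + ⟪lapOp d G x, ybar⟫ - (objective f xbar + ⟪lapOp d G xbar, y⟫)

/-- The perturbed gap function
`g(v, (x, y)) = sup_{ȳ ∈ ℝ^{md}} Q(x, y; x*, ȳ) - ⟨v, ȳ⟩`, with values in `[-∞, ∞]`. -/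
def perturbedGap {m d : ℕ} (G : SimpleGraph (Fin m)) [DecidableRel G.Adj]
    (f : Fin m → Vec d → ℝ) (xs v x y : Stack m d) : EReal :=
  ⨆ ybar : Stack m d, ((gapQ G f x y xs ybar - ⟪v, ybar⟫ : ℝ) : EReal)

/-! ### Parameters -/

/-- The parameters `α_k, θ_k, η_k, τ_k, T_k` of the outer loop and `λ_t, β_t` of the inner loop. -/
structure Params where
  α : ℕ → ℝ
  θ : ℕ → ℝ
  η : ℕ → ℝ
  τ : ℕ → ℝ
  T : ℕ → ℕ
  lam : ℕ → ℝ
  β : ℕ → ℝ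

/-- The conditions on the parameters over the horizon `N`, where `normL` stands for `‖𝐋‖`. -/
structure Params.Admissible (c : Params) (normL : ℝ) (N : ℕ) : Prop where
  α_nonneg : ∀ k ∈ Finset.Icc 1 N, 0 ≤ c.α k
  θ_pos : ∀ k ∈ Finset.Icc 1 N, 0 < c.θ k
  η_pos : ∀ k ∈ Finset.Icc 1 N, 0 < c.η k
  τ_pos : ∀ k ∈ Finset.Icc 1 N, 0 < c.τ k
  T_pos : ∀ k ∈ Finset.Icc 1 N, 1 ≤ c.T k
  α_θ : ∀ k ∈ Finset.Icc 2 N, c.α k * c.θ k = c.θ (k - 1)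
  θ_τ : ∀ k ∈ Finset.Icc 2 N, c.θ k * c.τ k ≤ c.θ (k - 1) * c.τ (k - 1)
  α_norm : ∀ k ∈ Finset.Icc 2 N, c.α k * normL ^ 2 ≤ c.η (k - 1) * c.τ k
  θ_τ_ends : c.θ 1 * c.τ 1 = c.θ N * c.τ N
  θ_norm : c.θ N * normL ^ 2 ≤ c.θ 1 * c.τ 1 * c.η N
  θ_η_T : ∀ k ∈ Finset.Icc 2 N,
    c.θ k * (((c.T k + 1 : ℝ) * (c.T k + 2) * c.η k) / (c.T k * (c.T k + 3))) ≤
      c.θ (k - 1) * (((c.T (k - 1) + 1 : ℝ) * (c.T (k - 1) + 2) * c.η (k - 1)) /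
        (c.T (k - 1) * (c.T (k - 1) + 3)))
  lam_eq : ∀ t : ℕ, 1 ≤ t → c.lam t = t + 1
  β_eq : ∀ t : ℕ, 1 ≤ t → c.β t = t / 2

/-! ### The algorithm -/

/-- One call `(xout, xhat) = CS(φ, U, V, T, η, w, x)` of the communication-sliding procedure:
`h t` is the (stochastic) subgradient used at the inner iterate `u t`. -/
structure IsCSRun {d : ℕ} (U : Set (Vec d)) (ω : Vec d → ℝ) (gradω : Vec d → Vec d) (T : ℕ)
    (η : ℝ) (lam β : ℕ → ℝ) (w x : Vec d) (h u : ℕ → Vec d) (xout xhat : Vec d) : Prop where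
  init : u 0 = x
  mem : ∀ t ∈ Finset.Icc 1 T, u t ∈ U
  isMin : ∀ t ∈ Finset.Icc 1 T,
    IsMinOn (fun v => ⟪w + h (t - 1), v⟫ + η * prox ω gradω x v +
      η * β t * prox ω gradω (u (t - 1)) v) U (u t)
  out : xout = u T
  avg : xhat = (∑ t ∈ Finset.Icc 1 T, lam t)⁻¹ • ∑ t ∈ Finset.Icc 1 T, lam t • u t

/-- All the vectors that one realization of the algorithm produces: `xt k`, `v k`, `y k`, `w k`,
`x k`, `xhat k` belong to outer iteration `k`, and `u k t i` is agent `i`'s `t`-th inner iterate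
in outer iteration `k`. -/
structure Iterates (m d : ℕ) where
  xt : ℕ → Stack m d
  v : ℕ → Stack m d
  y : ℕ → Stack m d
  w : ℕ → Stack m d
  x : ℕ → Stack m d
  xhat : ℕ → Stack m d
  u : ℕ → ℕ → Fin m → Vec d

/-- `z` is generated by `N` outer iterations of the SDCS algorithm from `(x0, y0)`;
`H i k t u` is the stochastic subgradient of `f_i` which the oracle returns at the point `u` when
agent `i` calls it at inner index `t` of outer iteration `k`. -/
structure IsSDCSRun {m d : ℕ} (G : SimpleGraph (Fin m)) [DecidableRel G.Adj]
    (X : Fin m → Set (Vec d)) (ω : Fin m → Vec d → ℝ) (gradω : Fin m → Vec d → Vec d)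
    (c : Params) (N : ℕ) (x0 y0 : Stack m d) (H : Fin m → ℕ → ℕ → Vec d → Vec d)
    (z : Iterates m d) : Prop where
  x_zero : z.x 0 = x0
  xhat_zero : z.xhat 0 = x0
  y_zero : z.y 0 = y0
  /-- For `k = 1` the index `k - 2` truncates to `0`, in accordance with `x^{-1} = x^0`. -/
  predict : ∀ k ∈ Finset.Icc 1 N,
    z.xt k = c.α k • (z.xhat (k - 1) - z.x (k - 2)) + z.x (k - 1)
  disagree : ∀ k ∈ Finset.Icc 1 N, z.v k = lapOp d G (z.xt k)
  dual : ∀ k ∈ Finset.Icc 1 N, z.y k = z.y (k - 1) + (1 / c.τ k) • z.v k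
  dual_comm : ∀ k ∈ Finset.Icc 1 N, z.w k = lapOp d G (z.y k)
  slide : ∀ k ∈ Finset.Icc 1 N, ∀ i,
    IsCSRun (X i) (ω i) (gradω i) (c.T k) (c.η k) c.lam c.β (z.w k i) (z.x (k - 1) i)
      (fun t => H i k t (z.u k t i)) (fun t => z.u k t i) (z.x k i) (z.xhat k i)

/-- `x̂^N = (∑ θ_k)⁻¹ ∑ θ_k x̂^k`, the primal part of `ẑ^N`. -/
def Iterates.xAvg {m d : ℕ} (z : Iterates m d) (c : Params) (N : ℕ) : Stack m d :=
  (∑ k ∈ Finset.Icc 1 N, c.θ k)⁻¹ • ∑ k ∈ Finset.Icc 1 N, c.θ k • z.xhat k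

/-- `(∑ θ_k)⁻¹ ∑ θ_k y^k`, the dual part of `ẑ^N`. -/
def Iterates.yAvg {m d : ℕ} (z : Iterates m d) (c : Params) (N : ℕ) : Stack m d :=
  (∑ k ∈ Finset.Icc 1 N, c.θ k)⁻¹ • ∑ k ∈ Finset.Icc 1 N, c.θ k • z.y k

/-- `v̂^N = (∑ θ_k)⁻¹ [θ_N 𝐋(x̂^N - x^{N-1}) + θ_1 τ_1 (y^N - y^0)]`, where `x̂^N` is the last
outer iterate. -/
def Iterates.vHat {m d : ℕ} (z : Iterates m d) (G : SimpleGraph (Fin m)) [DecidableRel G.Adj]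
    (c : Params) (N : ℕ) : Stack m d :=
  (∑ k ∈ Finset.Icc 1 N, c.θ k)⁻¹ •
    (c.θ N • lapOp d G (z.xhat N - z.x (N - 1)) + (c.θ 1 * c.τ 1) • (z.y N - z.y 0))

/-! ### The stochastic oracle -/

/-- `Gor i u (ξ i k t)` is an unbiased stochastic subgradient of `f_i` at `u` with variance bounded
by `σ²` and light tails; the random vectors `ξ i k t` are mutually independent. -/
structure IsStochOracle {m d : ℕ} {Ω Ξ : Type*} [MeasurableSpace Ω] [MeasurableSpace Ξ]
    (P : Measure Ω) (p : Fin m → Seminorm ℝ (Vec d)) (X : Fin m → Set (Vec d))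
    (f' : Fin m → Vec d → Vec d) (σ : ℝ) (Gor : Fin m → Vec d → Ξ → Vec d)
    (ξ : Fin m → ℕ → ℕ → Ω → Ξ) : Prop where
  measurable_oracle : ∀ i, Measurable (fun q : Vec d × Ξ => Gor i q.1 q.2)
  measurable_noise : ∀ i k t, Measurable (ξ i k t)
  indep : iIndepFun (fun (q : Fin m × ℕ × ℕ) => ξ q.1 q.2.1 q.2.2) P
  integrable : ∀ i k t, ∀ u ∈ X i, Integrable (fun s => Gor i u (ξ i k t s)) P
  unbiased : ∀ i k t, ∀ u ∈ X i, ∫ s, Gor i u (ξ i k t s) ∂P = f' i u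
  variance : ∀ i k t, ∀ u ∈ X i,
    ∫⁻ s, ENNReal.ofReal ((dualNorm (p i) (Gor i u (ξ i k t s) - f' i u)) ^ 2) ∂P ≤
      ENNReal.ofReal (σ ^ 2)
  light_tail : ∀ i k t, ∀ u ∈ X i,
    ∫⁻ s, ENNReal.ofReal
        (Real.exp ((dualNorm (p i) (Gor i u (ξ i k t s) - f' i u)) ^ 2 / σ ^ 2)) ∂P ≤
      ENNReal.ofReal (Real.exp 1)

/-! ### The two bounds -/

/-- The quantity `B_d(N)`; `V0` stands for `𝐕(x^0, x*)`. -/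
def boundD {m d : ℕ} (c : Params) (N : ℕ) (M σ V0 : ℝ) (y0 : Stack m d) : ℝ :=
  (∑ k ∈ Finset.Icc 1 N, c.θ k)⁻¹ *
    (((c.T 1 + 1 : ℝ) * (c.T 1 + 2) * c.θ 1 * c.η 1) / (c.T 1 * (c.T 1 + 3)) * V0 +
      c.θ 1 * c.τ 1 / 2 * ‖y0‖ ^ 2 +
      ∑ k ∈ Finset.Icc 1 N, 8 * m * (M ^ 2 + σ ^ 2) * c.θ k / (c.η k * (c.T k + 3)))

/-- The quantity `B_p(N)`; `Vbar` stands for `∑ i, max_{x_i ∈ X_i} V_i(x*_i, x_i)`. -/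
def boundP (m : ℕ) (c : Params) (N : ℕ) (σ Vbar : ℝ) : ℝ :=
  (∑ k ∈ Finset.Icc 1 N, c.θ k)⁻¹ *
    (σ * Real.sqrt (2 * Vbar * ∑ k ∈ Finset.Icc 1 N, ∑ t ∈ Finset.Icc 1 (c.T k),
        (c.θ k * c.lam t / ∑ s ∈ Finset.Icc 1 (c.T k), c.lam s) ^ 2) +
      ∑ k ∈ Finset.Icc 1 N, ∑ t ∈ Finset.Icc 1 (c.T k), ∑ _i : Fin m,
        σ ^ 2 * c.θ k * c.lam t /
          ((∑ s ∈ Finset.Icc 1 (c.T k), c.lam s) * c.η k * c.β t))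

end SDCS

end

namespace SDCS

/-! ### Norms on `ℝ^d` and their duals -/

/-! Along every realization the gap obeys a deterministic inequality in which only two error sums
are random. A single prox-step costs `(M² + ‖δ‖²_*) / (η β_t) + ⟨δ, x* - u^{t-1}⟩`, where `δ` is the
oracle error. The choice `λ_t = t + 1`, `β_t = t / 2` makes the Bregman terms telescope over `t`
(`IsCSRun.average_le`), and the primal-dual recursion `primal_dual_sum_le` telescopes over `k`. The
conditions on `θ τ` force this product to be constant, so the squares `‖ȳ - y^k‖²` telescope exactly
and `‖ȳ‖²` cancels. What is left of `ȳ` is the linear term `⟨v̂, ȳ⟩`, which the perturbed gap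
subtracts, so the bound is uniform in `ȳ`. This gives `g ≤ B_d + (∑ θ_k)⁻¹ (noiseLin + noiseQuad -
quadBound)` in `IsSDCSRun.perturbedGap_le`.

A union bound remains. `noiseLin` is a sum of martingale differences: the iterate at which the
oracle is called depends only on earlier noise, and each difference is conditionally sub-Gaussian by
`lintegral_exp_le_of_light_tail`. Chernoff's bound then yields `exp(-ζ²/3)`. `noiseQuad / quadBound`
is a convex combination of the variables `‖δ‖²_* / σ²`, so Jensen's and Markov's inequalities yield
`exp(-ζ)`.

Conditioning on the past needs measurable iterates, although `z` is just a choice of one run per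
outcome. Strong convexity makes each argmin unique and a continuous function of the linear data
(`proxMap`), so the iterates are functions of the past noise. In the same spirit `f'` is replaced by
`oracleMean`, which is measurable and agrees with `f'` on `X i`. -/

lemma continuous_seminorm {d : ℕ} (p : Seminorm ℝ (Vec d)) : Continuous p :=
  continuousOn_univ.1 (p.convexOn.continuousOn isOpen_univ)

lemma exists_norm_le_seminorm {d : ℕ} (p : Seminorm ℝ (Vec d)) (hp : ∀ x, p x = 0 → x = 0) :
    ∃ C, 0 ≤ C ∧ ∀ x, ‖x‖ ≤ C * p x := by
  rcases (Metric.sphere (0 : Vec d) 1).eq_empty_or_nonempty with he | hne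
  -- The unit sphere is empty only if every vector is zero, and then `C = 0` serves.
  · refine ⟨0, le_rfl, fun x => ?_⟩
    by_contra hx
    have hx0 : ‖x‖ ≠ 0 := fun h => hx (by simp [h])
    have : (‖x‖⁻¹ • x) ∈ Metric.sphere (0 : Vec d) 1 := by
      simp [norm_smul, hx0]
    simp [he] at this
  · obtain ⟨v, hv, hmin⟩ :=
      (isCompact_sphere (0 : Vec d) 1).exists_isMinOn hne (continuous_seminorm p).continuousOn
    have hv1 : ‖v‖ = 1 := by simpa using hv
    have hpos : 0 < p v := by
      refine lt_of_le_of_ne (apply_nonneg p v) fun h => ?_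
      have := hp v h.symm
      simp [this] at hv1
    refine ⟨(p v)⁻¹, by positivity, fun x => ?_⟩
    by_cases hx : x = 0
    · simp [hx]
    have hx0 : 0 < ‖x‖ := norm_pos_iff.2 hx
    have hmem : (‖x‖⁻¹ • x) ∈ Metric.sphere (0 : Vec d) 1 := by
      simp [norm_smul, hx0.ne']
    have h1 : p v ≤ p (‖x‖⁻¹ • x) := hmin hmem
    rw [map_smul_eq_mul, norm_inv, norm_norm, inv_mul_eq_div, le_div_iff₀ hx0] at h1
    rw [inv_mul_eq_div, le_div_iff₀ hpos]
    linarith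

section DualNorm

variable {d : ℕ} {p : Seminorm ℝ (Vec d)}

/-- The real `sSup` of a set unbounded above is `0`, so `dualNorm` is the true supremum only because
a definite `p` dominates the Euclidean norm. -/
lemma bddAbove_dualNorm (hp : ∀ x, p x = 0 → x = 0) (g : Vec d) :
    BddAbove ((fun x : Vec d => ⟪g, x⟫) '' {x | p x ≤ 1}) := by
  obtain ⟨C, hC, h⟩ := exists_norm_le_seminorm p hp
  refine ⟨‖g‖ * C, ?_⟩
  rintro _ ⟨x, hx, rfl⟩
  have hx' : p x ≤ 1 := hx
  calc ⟪g, x⟫ ≤ ‖g‖ * ‖x‖ := real_inner_le_norm g x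
    _ ≤ ‖g‖ * C := by
      gcongr
      nlinarith [h x]

lemma inner_le_dualNorm_mul (hp : ∀ x, p x = 0 → x = 0) (g x : Vec d) :
    ⟪g, x⟫ ≤ dualNorm p g * p x := by
  by_cases hx : p x = 0
  · simp [hp x hx]
  have hpos : 0 < p x := lt_of_le_of_ne (apply_nonneg p x) (Ne.symm hx)
  have h1 : ⟪g, (p x)⁻¹ • x⟫ ≤ dualNorm p g := by
    refine le_csSup (bddAbove_dualNorm hp g) ⟨(p x)⁻¹ • x, ?_, rfl⟩
    simp [map_smul_eq_mul, abs_of_pos hpos, hx]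
  rw [inner_smul_right, inv_mul_eq_div, div_le_iff₀ hpos] at h1
  exact h1

lemma abs_inner_le_dualNorm_mul (hp : ∀ x, p x = 0 → x = 0) (g x : Vec d) :
    |⟪g, x⟫| ≤ dualNorm p g * p x := by
  refine abs_le'.2 ⟨inner_le_dualNorm_mul hp g x, ?_⟩
  simpa using inner_le_dualNorm_mul hp g (-x)

/-- A supremum of linear functionals with Euclidean norm at most `C` is `C`-Lipschitz. Continuity is
what makes the dual norm of the oracle error measurable. -/
lemma continuous_dualNorm (hp : ∀ x, p x = 0 → x = 0) : Continuous (dualNorm p) := by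
  obtain ⟨C, hC, h⟩ := exists_norm_le_seminorm p hp
  refine (LipschitzWith.of_le_add_mul ⟨C, hC⟩ fun g g' => ?_).continuous
  refine csSup_le ⟨_, 0, by simp, rfl⟩ ?_
  rintro _ ⟨x, hx, rfl⟩
  have hx' : p x ≤ 1 := hx
  have h1 : ⟪g', x⟫ ≤ dualNorm p g' := le_csSup (bddAbove_dualNorm hp g') ⟨x, hx, rfl⟩
  have h2 : ⟪g - g', x⟫ ≤ ‖g - g'‖ * C :=
    (real_inner_le_norm _ x).trans (by gcongr; nlinarith [h x])
  rw [inner_sub_left] at h2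
  rw [dist_eq_norm]
  change ⟪g, x⟫ ≤ dualNorm p g' + C * ‖g - g'‖
  linarith

end DualNorm

/-! ### The operator `𝐋` -/

section Laplacian

variable {m d : ℕ} (G : SimpleGraph (Fin m)) [DecidableRel G.Adj]

/-- `𝐋` as a linear map. -/
def lapLin (d : ℕ) : Stack m d →ₗ[ℝ] Stack m d where
  toFun := lapOp d G
  map_add' x y := by
    ext i a
    simp [lapOp, smul_add, Finset.sum_add_distrib]
  map_smul' r x := by
    ext i a
    simp only [lapOp, PiLp.smul_apply, RingHom.id_apply, Finset.smul_sum]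
    exact congrArg (fun v : Vec d => v a)
      (Finset.sum_congr rfl fun j _ => smul_comm _ _ _)

lemma lapLin_apply (x : Stack m d) : lapLin G d x = lapOp d G x := rfl

lemma inner_lapOp_left (x y : Stack m d) : ⟪lapOp d G x, y⟫ = ⟪x, lapOp d G y⟫ := by
  simp only [PiLp.inner_apply, lapOp, sum_inner, inner_sum, inner_smul_left, inner_smul_right]
  rw [Finset.sum_comm]
  refine Finset.sum_congr rfl fun i _ => Finset.sum_congr rfl fun j _ => ?_
  have : G.lapMatrix ℝ j i = G.lapMatrix ℝ i j := (SimpleGraph.isSymm_lapMatrix ℝ G).apply i j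
  simp [this]

lemma primalNorm_nonneg (p : Fin m → Seminorm ℝ (Vec d)) (x : Stack m d) : 0 ≤ primalNorm p x :=
  Real.sqrt_nonneg _

lemma primalNorm_sq (p : Fin m → Seminorm ℝ (Vec d)) (x : Stack m d) :
    primalNorm p x ^ 2 = ∑ i, (p i (x i)) ^ 2 :=
  Real.sq_sqrt (Finset.sum_nonneg fun _ _ => sq_nonneg _)

lemma primalNorm_smul (p : Fin m → Seminorm ℝ (Vec d)) (r : ℝ) (hr : 0 ≤ r) (x : Stack m d) :
    primalNorm p (r • x) = r * primalNorm p x := by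
  have h : ∑ i, (p i ((r • x) i)) ^ 2 = r ^ 2 * ∑ i, (p i (x i)) ^ 2 := by
    simp [map_smul_eq_mul, mul_pow, Finset.mul_sum]
  rw [primalNorm, h, Real.sqrt_mul (sq_nonneg r), Real.sqrt_sq hr, primalNorm]

lemma exists_norm_le_primalNorm {p : Fin m → Seminorm ℝ (Vec d)}
    (hp : ∀ i x, p i x = 0 → x = 0) : ∃ C, 0 ≤ C ∧ ∀ x : Stack m d, ‖x‖ ≤ C * primalNorm p x := by
  choose C hC h using fun i => exists_norm_le_seminorm (p i) (hp i)
  have hD : ∀ i, C i ≤ ∑ j, C j := fun i =>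
    Finset.single_le_sum (f := C) (fun j _ => hC j) (Finset.mem_univ i)
  have hD0 : 0 ≤ ∑ j, C j := Finset.sum_nonneg fun j _ => hC j
  refine ⟨∑ j, C j, hD0, fun x => ?_⟩
  refine abs_le_of_sq_le_sq' ?_ (mul_nonneg hD0 (primalNorm_nonneg p x)) |>.2
  rw [mul_pow, primalNorm_sq, PiLp.norm_sq_eq_of_L2, Finset.mul_sum]
  refine Finset.sum_le_sum fun i _ => ?_
  rw [← mul_pow]
  refine pow_le_pow_left₀ (norm_nonneg _) ((h i _).trans ?_) 2
  exact mul_le_mul_of_nonneg_right (hD i) (apply_nonneg _ _)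

lemma norm_lapOp_le {p : Fin m → Seminorm ℝ (Vec d)} (hp : ∀ i x, p i x = 0 → x = 0)
    (x : Stack m d) : ‖lapOp d G x‖ ≤ lapNorm G p * primalNorm p x := by
  obtain ⟨C, hC, h⟩ := exists_norm_le_primalNorm hp
  have : ContinuousSMul ℝ (Stack m d) := IsBoundedSMul.continuousSMul
  set A : Stack m d →L[ℝ] Stack m d := (lapLin G d).toContinuousLinearMap with hA
  have hAx : ∀ y, A y = lapOp d G y := fun y => rfl
  have hbdd : BddAbove ((fun x : Stack m d => ‖lapOp d G x‖) '' {x | primalNorm p x ≤ 1}) := by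
    refine ⟨‖A‖ * C, ?_⟩
    rintro _ ⟨y, hy, rfl⟩
    have hy' : primalNorm p y ≤ 1 := hy
    simp only [← hAx]
    refine (A.le_opNorm y).trans ?_
    gcongr
    nlinarith [h y]
  rcases (primalNorm_nonneg p x).eq_or_lt with h0 | hpos
  · have hx : x = 0 := by
      have := h x
      rw [← h0, mul_zero] at this
      exact norm_le_zero_iff.1 this
    rw [← h0, hx, ← lapLin_apply]
    simp
  · have h1 : ‖lapOp d G ((primalNorm p x)⁻¹ • x)‖ ≤ lapNorm G p := by
      refine le_csSup hbdd ⟨_, ?_, rfl⟩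
      simp only [Set.mem_ofPred_eq]
      rw [primalNorm_smul _ _ (by positivity), inv_mul_cancel₀ hpos.ne']
    rw [← lapLin_apply, map_smul, norm_smul, norm_inv, Real.norm_of_nonneg hpos.le,
      inv_mul_eq_div, div_le_iff₀ hpos] at h1
    exact h1

end Laplacian

/-! ### Prox-functions -/

section Prox

variable {d : ℕ} {p : Seminorm ℝ (Vec d)} {U : Set (Vec d)} {ω : Vec d → ℝ}
  {gradω : Vec d → Vec d}

lemma IsDistGen.continuousOn {ν : ℝ} (h : IsDistGen p U ν ω gradω) : ContinuousOn ω U :=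
  fun x hx => (h.hasGradient x hx).continuousWithinAt

/-- Strong convexity of the distance generating function bounds the prox-function below. -/
lemma IsDistGen.sq_le_prox (h : IsDistGen p U 1 ω gradω) (hU : Convex ℝ U) {x u : Vec d}
    (hx : x ∈ U) (hu : u ∈ U) : p (x - u) ^ 2 / 2 ≤ prox ω gradω x u := by
  set D := u - x with hD
  have hmem : ∀ s ∈ Set.Icc (0 : ℝ) 1, x + s • D ∈ U := fun s hs =>
    hU.add_smul_sub_mem hx hu hs
  have hline : ∀ s ∈ Set.Icc (0 : ℝ) 1, HasDerivWithinAt (fun s : ℝ => ω (x + s • D))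
      ⟪gradω (x + s • D), D⟫ (Set.Icc 0 1) s := by
    intro s hs
    have h1 := (h.hasGradient _ (hmem s hs)).hasFDerivWithinAt
    have h2 : HasDerivWithinAt (fun s : ℝ => x + s • D) D (Set.Icc 0 1) s := by
      simpa using (((hasDerivAt_id s).smul_const D).const_add x).hasDerivWithinAt
    simpa [Function.comp_def] using h1.comp_hasDerivWithinAt s h2 hmem
  -- With its tangent and the quadratic removed, `ω` is monotone along the segment; comparing the
  -- endpoints gives the bound.
  set φ : ℝ → ℝ := fun s => ω (x + s • D) - s * ⟪gradω x, D⟫ - s ^ 2 / 2 * p D ^ 2 with hφ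
  have hφd : ∀ s ∈ Set.Icc (0 : ℝ) 1, HasDerivWithinAt φ
      (⟪gradω (x + s • D), D⟫ - ⟪gradω x, D⟫ - s * p D ^ 2) (Set.Icc 0 1) s := by
    intro s hs
    have h1 : HasDerivAt (fun s : ℝ => s * ⟪gradω x, D⟫) ⟪gradω x, D⟫ s := by
      simpa using (hasDerivAt_id s).mul_const ⟪gradω x, D⟫
    have h2 : HasDerivAt (fun s : ℝ => s ^ 2 / 2 * p D ^ 2) (s * p D ^ 2) s := by
      refine ((((hasDerivAt_id s).pow 2).div_const 2).mul_const (p D ^ 2)).congr_deriv ?_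
      simp
    exact ((hline s hs).sub h1.hasDerivWithinAt).sub h2.hasDerivWithinAt
  have hmono : MonotoneOn φ (Set.Icc 0 1) := by
    refine monotoneOn_of_deriv_nonneg (convex_Icc 0 1)
      (fun s hs => (hφd s hs).continuousWithinAt) ?_ ?_
    · intro s hs
      exact ((hφd s (interior_subset hs)).mono interior_subset).differentiableWithinAt
    · intro s hs
      have hs' : s ∈ Set.Icc (0 : ℝ) 1 := interior_subset hs
      rw [((hφd s hs').hasDerivAt (mem_interior_iff_mem_nhds.1 hs)).deriv]
      rw [interior_Icc] at hs
      have h3 := h.strong _ (hmem s hs') x hx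
      rw [add_sub_cancel_left, map_smul_eq_mul, inner_smul_right, inner_sub_left, mul_pow,
        Real.norm_eq_abs, sq_abs, one_mul] at h3
      -- Strong monotonicity between `x + s • D` and `x` carries an extra factor `s`, which cancels
      -- because `s > 0` in the interior.
      have h4 : s * (s * p D ^ 2) ≤ s * (⟪gradω (x + s • D), D⟫ - ⟪gradω x, D⟫) := by linarith
      have := le_of_mul_le_mul_left h4 hs.1
      linarith
  have h01 := hmono (Set.left_mem_Icc.2 zero_le_one) (Set.right_mem_Icc.2 zero_le_one) zero_le_one
  have hpD : p (x - u) = p D := by rw [hD, map_sub_rev]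
  simp only [hφ, zero_smul, add_zero, one_smul, zero_mul, sub_zero] at h01
  rw [show x + D = u by simp [hD]] at h01
  rw [hpD, prox]
  linarith

lemma IsDistGen.prox_nonneg (h : IsDistGen p U 1 ω gradω) (hU : Convex ℝ U) {x u : Vec d}
    (hx : x ∈ U) (hu : u ∈ U) : 0 ≤ prox ω gradω x u :=
  (by positivity : (0 : ℝ) ≤ p (x - u) ^ 2 / 2).trans (h.sq_le_prox hU hx hu)

lemma IsDistGen.bddAbove_prox (h : IsDistGen p U 1 ω gradω) (hU : IsCompact U) (x : Vec d) :
    BddAbove (prox ω gradω x '' U) := by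
  refine (hU.image_of_continuousOn ?_).bddAbove
  have := h.continuousOn
  unfold prox
  fun_prop

/-- First order optimality for the minimization of a linear function plus a multiple of `ω`. -/
lemma IsDistGen.inner_nonneg_of_isMinOn {ν : ℝ} (h : IsDistGen p U ν ω gradω) (hU : Convex ℝ U)
    {ℓ v u : Vec d} {κ c : ℝ} (hv : v ∈ U) (hu : u ∈ U)
    (hmin : IsMinOn (fun y => ⟪ℓ, y⟫ + κ * ω y + c) U v) :
    0 ≤ ⟪ℓ + κ • gradω v, u - v⟫ := by
  have h1 := (h.hasGradient v hv).hasFDerivWithinAt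
  have h2 : HasFDerivWithinAt (fun y => ⟪ℓ, y⟫ + κ * ω y + c)
      (innerSL ℝ ℓ + κ • (InnerProductSpace.toDual ℝ (Vec d)) (gradω v)) U v :=
    (((innerSL ℝ ℓ).hasFDerivAt.hasFDerivWithinAt).add (h1.const_mul κ)).add_const c
  have h3 := hmin.localize.hasFDerivWithinAt_nonneg h2
    (sub_mem_posTangentConeAt_of_segment_subset (hU.segment_subset hv hu))
  simpa [inner_add_left, inner_smul_left] using h3

/-- The objective of the inner subproblem, as a linear function plus a multiple of `ω`. -/
lemma subproblem_eq (g x y v : Vec d) (η b : ℝ) :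
    ⟪g, v⟫ + η * prox ω gradω x v + η * b * prox ω gradω y v =
      ⟪g - η • gradω x - (η * b) • gradω y, v⟫ + η * (1 + b) * ω v +
        (η * (⟪gradω x, x⟫ - ω x) + η * b * (⟪gradω y, y⟫ - ω y)) := by
  simp only [prox, inner_sub_left, inner_sub_right, inner_smul_left, RCLike.conj_to_real]
  ring

/-- The three-point inequality for one prox-step. -/
lemma IsDistGen.three_point {ν : ℝ} (h : IsDistGen p U ν ω gradω) (hU : Convex ℝ U)
    {g x y v u : Vec d} {η b : ℝ} (hv : v ∈ U) (hu : u ∈ U)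
    (hmin : IsMinOn (fun v => ⟪g, v⟫ + η * prox ω gradω x v + η * b * prox ω gradω y v) U v) :
    ⟪g, v - u⟫ + η * prox ω gradω x v + η * b * prox ω gradω y v ≤
      η * prox ω gradω x u + η * b * prox ω gradω y u - η * (1 + b) * prox ω gradω v u := by
  simp only [subproblem_eq] at hmin
  have h1 := h.inner_nonneg_of_isMinOn hU hv hu hmin
  simp only [prox, inner_add_left, inner_sub_left, inner_sub_right, inner_smul_left,
    RCLike.conj_to_real] at h1 ⊢
  nlinarith

/-! ### The prox-mapping -/

/-- A minimizer over `U` of `⟨ℓ, ·⟩ + κ ω`. -/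
noncomputable def proxMap (U : Set (Vec d)) (ω : Vec d → ℝ) (κ : ℝ) (ℓ : Vec d) : Vec d :=
  open Classical in
  if h : ∃ v ∈ U, IsMinOn (fun y => ⟪ℓ, y⟫ + κ * ω y) U v then h.choose else 0

lemma IsDistGen.proxMap_spec {ν : ℝ} (h : IsDistGen p U ν ω gradω) (hU : IsCompact U)
    (hne : U.Nonempty) (κ : ℝ) (ℓ : Vec d) : proxMap U ω κ ℓ ∈ U ∧
      IsMinOn (fun y => ⟪ℓ, y⟫ + κ * ω y) U (proxMap U ω κ ℓ) := by
  have hex : ∃ v ∈ U, IsMinOn (fun y => ⟪ℓ, y⟫ + κ * ω y) U v := by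
    refine hU.exists_isMinOn hne ?_
    have := h.continuousOn
    fun_prop
  rw [proxMap, dif_pos hex]
  exact hex.choose_spec

/-- Minimizers of `⟨ℓ, ·⟩ + κ ω` are Lipschitz in `ℓ`. -/
lemma IsDistGen.dist_minimizers_le (h : IsDistGen p U 1 ω gradω) (hU : Convex ℝ U) {C : ℝ}
    (hpC : ∀ x, ‖x‖ ≤ C * p x) {κ : ℝ} (hκ : 0 < κ) {ℓ ℓ' v v' : Vec d} {c c' : ℝ}
    (hv : v ∈ U) (hv' : v' ∈ U) (hmin : IsMinOn (fun y => ⟪ℓ, y⟫ + κ * ω y + c) U v)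
    (hmin' : IsMinOn (fun y => ⟪ℓ', y⟫ + κ * ω y + c') U v') :
    ‖v - v'‖ ≤ C ^ 2 / κ * ‖ℓ - ℓ'‖ := by
  -- The sum of the two variational inequalities is `κ ⟨∇ω(v) - ∇ω(v'), v - v'⟩ ≤ ⟨ℓ' - ℓ, v - v'⟩`;
  -- strong monotonicity bounds the left side below.
  have h1 := h.inner_nonneg_of_isMinOn hU hv hv' hmin
  have h2 := h.inner_nonneg_of_isMinOn hU hv' hv hmin'
  have h3 := h.strong v hv v' hv'
  have h4 : ⟪ℓ' - ℓ, v - v'⟫ ≤ ‖ℓ - ℓ'‖ * ‖v - v'‖ := by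
    rw [norm_sub_rev ℓ ℓ']
    exact real_inner_le_norm _ _
  have h5 : κ * p (v - v') ^ 2 ≤ ‖ℓ - ℓ'‖ * ‖v - v'‖ := by
    refine le_trans ?_ h4
    simp only [inner_add_left, inner_sub_left, inner_sub_right, inner_smul_left,
      RCLike.conj_to_real] at h1 h2 h3 ⊢
    nlinarith
  have h6 : ‖v - v'‖ ^ 2 ≤ C ^ 2 * p (v - v') ^ 2 := by
    rw [← mul_pow]
    exact pow_le_pow_left₀ (norm_nonneg _) (hpC _) 2
  rcases (norm_nonneg (v - v')).eq_or_lt with h0 | hpos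
  · rw [← h0]
    positivity
  refine le_of_mul_le_mul_right ?_ hpos
  rw [div_mul_eq_mul_div, div_mul_eq_mul_div, le_div_iff₀ hκ]
  nlinarith [mul_le_mul_of_nonneg_left h5 (sq_nonneg C)]

lemma IsDistGen.continuous_proxMap (h : IsDistGen p U 1 ω gradω) (hU : Convex ℝ U)
    (hUc : IsCompact U) (hne : U.Nonempty) (hp : ∀ x, p x = 0 → x = 0) {κ : ℝ} (hκ : 0 < κ) :
    Continuous (proxMap U ω κ) := by
  obtain ⟨C, hC, hpC⟩ := exists_norm_le_seminorm p hp
  refine (LipschitzWith.of_dist_le_mul (K := ⟨C ^ 2 / κ, by positivity⟩) fun ℓ ℓ' => ?_).continuous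
  have h1 := h.proxMap_spec hUc hne κ ℓ
  have h2 := h.proxMap_spec hUc hne κ ℓ'
  rw [dist_eq_norm, dist_eq_norm]
  exact h.dist_minimizers_le hU hpC hκ (c := 0) (c' := 0) h1.1 h2.1
    (by simpa using h1.2) (by simpa using h2.2)

/-- The solution of the inner subproblem is the value of the prox-mapping. -/
lemma IsDistGen.eq_proxMap (h : IsDistGen p U 1 ω gradω) (hU : Convex ℝ U)
    (hUc : IsCompact U) (hp : ∀ x, p x = 0 → x = 0) {g x y v : Vec d} {η b : ℝ}
    (hκ : 0 < η * (1 + b)) (hv : v ∈ U)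
    (hmin : IsMinOn (fun v => ⟪g, v⟫ + η * prox ω gradω x v + η * b * prox ω gradω y v) U v) :
    v = proxMap U ω (η * (1 + b)) (g - η • gradω x - (η * b) • gradω y) := by
  obtain ⟨C, -, hpC⟩ := exists_norm_le_seminorm p hp
  simp only [subproblem_eq] at hmin
  have h1 := h.proxMap_spec hUc ⟨v, hv⟩ (η * (1 + b)) (g - η • gradω x - (η * b) • gradω y)
  -- With equal linear parts the Lipschitz bound is zero, so the minimizer is unique.
  have := h.dist_minimizers_le hU hpC hκ (c' := 0) hv h1.1 hmin (by simpa using h1.2)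
  rw [sub_self, norm_zero, mul_zero] at this
  exact sub_eq_zero.1 (norm_le_zero_iff.1 this)

end Prox

/-! ### Weighted averages -/

section Average

variable {E : Type*} [AddCommGroup E] [Module ℝ E] {ι : Type*} {A : Finset ι} {a : ι → ℝ}
  {u : ι → E} {U : Set E}

lemma average_eq_sum (A : Finset ι) (a : ι → ℝ) (u : ι → E) :
    (∑ t ∈ A, a t)⁻¹ • ∑ t ∈ A, a t • u t = ∑ t ∈ A, ((∑ t ∈ A, a t)⁻¹ * a t) • u t := by
  rw [Finset.smul_sum]
  exact Finset.sum_congr rfl fun t _ => smul_smul _ _ _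

lemma average_mem (hU : Convex ℝ U) (ha : ∀ t ∈ A, 0 ≤ a t) (hpos : 0 < ∑ t ∈ A, a t)
    (hu : ∀ t ∈ A, u t ∈ U) : (∑ t ∈ A, a t)⁻¹ • ∑ t ∈ A, a t • u t ∈ U := by
  rw [average_eq_sum]
  refine hU.sum_mem (fun t ht => mul_nonneg (by positivity) (ha t ht)) ?_ hu
  rw [← Finset.mul_sum, inv_mul_cancel₀ hpos.ne']

lemma mul_map_average_le {g : E → ℝ} (hg : ConvexOn ℝ U g) (ha : ∀ t ∈ A, 0 ≤ a t)
    (hpos : 0 < ∑ t ∈ A, a t) (hu : ∀ t ∈ A, u t ∈ U) :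
    (∑ t ∈ A, a t) * g ((∑ t ∈ A, a t)⁻¹ • ∑ t ∈ A, a t • u t) ≤ ∑ t ∈ A, a t * g (u t) := by
  rw [average_eq_sum]
  have h1 := hg.map_sum_le (t := A) (w := fun t => (∑ t ∈ A, a t)⁻¹ * a t) (p := u)
    (fun t ht => mul_nonneg (by positivity) (ha t ht))
    (by rw [← Finset.mul_sum, inv_mul_cancel₀ hpos.ne']) hu
  simp only [smul_eq_mul, mul_assoc, ← Finset.mul_sum] at h1
  rwa [inv_mul_eq_div, le_div_iff₀ hpos, mul_comm] at h1

end Average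

/-! ### The inner loop -/

lemma sum_Icc_add_one (T : ℕ) : ∑ t ∈ Finset.Icc 1 T, ((t : ℝ) + 1) = T * (T + 3) / 2 := by
  induction T with
  | zero => simp
  | succ n ih =>
    rw [Finset.sum_Icc_succ_top (by omega), ih]
    push_cast
    ring

/-- The identity behind it is `λ_t (1 + β_t) = (t + 1)(t + 2) / 2 = λ_{t+1} β_{t+1}`, together with
`λ_1 β_1 = 1`. -/
lemma sum_Icc_telescope (a : ℕ → ℝ) (T : ℕ) :
    ∑ t ∈ Finset.Icc 1 T, ((t : ℝ) + 1) * (t / 2 * a (t - 1) - (1 + t / 2) * a t) =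
      a 0 - (T + 1) * (T + 2) / 2 * a T := by
  induction T with
  | zero => simp
  | succ n ih =>
    rw [Finset.sum_Icc_succ_top (by omega), ih]
    push_cast
    ring

/-- Completing the square in `r` gives `(M + D)² / (2κ)`, and `(M + D)² ≤ 2 (M² + D²)`. -/
lemma mul_sub_half_sq_le {M D r κ : ℝ} (hκ : 0 < κ) :
    (M + D) * r - κ * (r ^ 2 / 2) ≤ (M ^ 2 + D ^ 2) / κ := by
  rw [le_div_iff₀ hκ]
  nlinarith [sq_nonneg (M + D - κ * r), sq_nonneg (M - D)]

section InnerLoop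

variable {d : ℕ} {p : Seminorm ℝ (Vec d)} {U : Set (Vec d)} {ω f : Vec d → ℝ}
  {gradω f' : Vec d → Vec d} {M : ℝ}

/-- One stochastic subgradient prox-step. -/
lemma prox_step_le (hω : IsDistGen p U 1 ω gradω) (hU : Convex ℝ U) (hp : ∀ x, p x = 0 → x = 0)
    (hf' : ∀ x ∈ U, ∀ y ∈ U,
      0 ≤ f x - f y - ⟪f' y, x - y⟫ ∧ f x - f y - ⟪f' y, x - y⟫ ≤ M * p (x - y))
    {w h x y v u : Vec d} {η b : ℝ} (hη : 0 < η) (hb : 0 < b) (hy : y ∈ U) (hv : v ∈ U)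
    (hu : u ∈ U)
    (hmin : IsMinOn (fun v => ⟪w + h, v⟫ + η * prox ω gradω x v + η * b * prox ω gradω y v) U v) :
    ⟪w, v - u⟫ + f v - f u ≤
      η * prox ω gradω x u - η * prox ω gradω x v +
        η * (b * prox ω gradω y u - (1 + b) * prox ω gradω v u) +
        ((M ^ 2 + dualNorm p (h - f' y) ^ 2) / (η * b) + ⟪h - f' y, u - y⟫) := by
  have h1 := hω.three_point hU hv hu hmin
  have h2 := (hf' v hv y hy).2
  have h3 := (hf' u hu y hy).1
  -- The error is split at the old iterate `y`. The part along `u - y` is kept, since `y` is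
  -- independent of the noise in `h` and this part will have conditional mean zero; the part along
  -- `y - v` joins the `M`-term and is absorbed by the prox term.
  have h4 := inner_le_dualNorm_mul hp (h - f' y) (y - v)
  have h5 := hω.sq_le_prox hU hy hv
  have hκ : 0 < η * b := mul_pos hη hb
  have h6 := mul_le_mul_of_nonneg_left h5 hκ.le
  have h7 := mul_sub_half_sq_le (M := M) (D := dualNorm p (h - f' y)) (r := p (y - v)) hκ
  rw [map_sub_rev p v y] at h2
  simp only [inner_add_left, inner_sub_left, inner_sub_right] at h1 h2 h3 h4 ⊢
  linarith

/-- The estimate for one call of the communication-sliding procedure. -/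
lemma IsCSRun.average_le (hω : IsDistGen p U 1 ω gradω) (hU : Convex ℝ U)
    (hp : ∀ x, p x = 0 → x = 0) (hf : ConvexOn ℝ U f)
    (hf' : ∀ x ∈ U, ∀ y ∈ U,
      0 ≤ f x - f y - ⟪f' y, x - y⟫ ∧ f x - f y - ⟪f' y, x - y⟫ ≤ M * p (x - y))
    {T : ℕ} (hT : 1 ≤ T) {η : ℝ} (hη : 0 < η) {lam β : ℕ → ℝ}
    (hlam : ∀ t : ℕ, 1 ≤ t → lam t = t + 1) (hβ : ∀ t : ℕ, 1 ≤ t → β t = t / 2)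
    {w x xout xhat : Vec d} {h u : ℕ → Vec d}
    (hr : IsCSRun U ω gradω T η lam β w x h u xout xhat) (hx : x ∈ U) {v : Vec d} (hv : v ∈ U) :
    ⟪w, xhat - v⟫ + f xhat - f v ≤
      ((T + 1 : ℝ) * (T + 2) * η) / (T * (T + 3)) * (prox ω gradω x v - prox ω gradω xout v) -
        η / 2 * p (xhat - x) ^ 2 +
        ∑ t ∈ Finset.Icc 1 T, lam t / (∑ s ∈ Finset.Icc 1 T, lam s) *
          ((M ^ 2 + dualNorm p (h (t - 1) - f' (u (t - 1))) ^ 2) / (η * β t) +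
            ⟪h (t - 1) - f' (u (t - 1)), v - u (t - 1)⟫) := by
  have hT0 : (0 : ℝ) < T := by exact_mod_cast hT
  have hlam0 : ∀ t ∈ Finset.Icc 1 T, 0 ≤ lam t := fun t ht => by
    rw [hlam t (Finset.mem_Icc.1 ht).1]; positivity
  set Λ := ∑ t ∈ Finset.Icc 1 T, lam t with hΛ
  have hΛe : Λ = T * (T + 3) / 2 := by
    rw [hΛ, ← sum_Icc_add_one]
    exact Finset.sum_congr rfl fun t ht => hlam t (Finset.mem_Icc.1 ht).1
  have hΛ0 : 0 < Λ := by rw [hΛe]; positivity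
  have hmem : ∀ t ≤ T, u t ∈ U := fun t ht => by
    rcases Nat.eq_zero_or_pos t with rfl | h0
    · rw [hr.init]; exact hx
    · exact hr.mem t (Finset.mem_Icc.2 ⟨h0, ht⟩)
  have hmem' : ∀ t ∈ Finset.Icc 1 T, u t ∈ U := hr.mem
  set e : ℕ → ℝ := fun t => (M ^ 2 + dualNorm p (h (t - 1) - f' (u (t - 1))) ^ 2) / (η * β t) +
            ⟪h (t - 1) - f' (u (t - 1)), v - u (t - 1)⟫ with he
  have hstep : ∀ t ∈ Finset.Icc 1 T, lam t * (⟪w, u t - v⟫ + f (u t) - f v) ≤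
      lam t * (η * prox ω gradω x v) - η / 2 * (lam t * p (u t - x) ^ 2) +
        η * (((t : ℝ) + 1) * (t / 2 * prox ω gradω (u (t - 1)) v -
          (1 + t / 2) * prox ω gradω (u t) v)) + lam t * e t := by
    intro t ht
    obtain ⟨h1, h2⟩ := Finset.mem_Icc.1 ht
    have ht0 : (0 : ℝ) < t := by exact_mod_cast h1
    have hb : 0 < β t := by rw [hβ t h1]; positivity
    have h3 := prox_step_le hω hU hp hf' hη hb (hmem (t - 1) (by omega)) (hmem' t ht) hv
      (hr.isMin t ht)
    -- `-η V(x, u t)` is kept as a negative quadratic: in the outer loop it pays for the coupling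
    -- between primal and dual steps.
    have h4 := hω.sq_le_prox hU hx (hmem' t ht)
    rw [map_sub_rev] at h4
    have h5 := mul_le_mul_of_nonneg_left h4 hη.le
    have h6 : ⟪w, u t - v⟫ + f (u t) - f v ≤ η * prox ω gradω x v - η / 2 * p (u t - x) ^ 2 +
        η * (β t * prox ω gradω (u (t - 1)) v - (1 + β t) * prox ω gradω (u t) v) + e t := by
      simp only [he]
      linarith
    have h7 := mul_le_mul_of_nonneg_left h6 (hlam0 t ht)
    rw [hβ t h1] at h7
    have h8 := hlam t h1
    simp only [h8] at h7 ⊢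
    linarith
  have hsum := Finset.sum_le_sum hstep
  simp only [Finset.sum_add_distrib, Finset.sum_sub_distrib, ← Finset.mul_sum, ← Finset.sum_mul]
    at hsum
  rw [sum_Icc_telescope (fun t => prox ω gradω (u t) v) T] at hsum
  simp only [hr.init, ← hr.out, ← hΛ] at hsum
  have hw : ConvexOn ℝ U (fun y => ⟪w, y - v⟫ + f y - f v) := by
    have hl : ConvexOn ℝ U (fun y => ⟪w, y⟫) := ((innerSL ℝ w).toLinearMap.convexOn hU)
    refine ((hl.add hf).add_const (-⟪w, v⟫ - f v)).congr fun y _ => ?_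
    simp only [Pi.add_apply, inner_sub_right]
    ring
  have h1 := mul_map_average_le hw hlam0 hΛ0 hmem'
  have hsq : ConvexOn ℝ Set.univ (fun y => p (y - x) ^ 2) := by
    have := (p.convexOn.translate_left (-x)).pow (fun _ _ => apply_nonneg _ _) 2
    simp only [sub_eq_add_neg]
    exact this
  have h2 := mul_map_average_le hsq hlam0 hΛ0 (fun t _ => Set.mem_univ (u t))
  rw [← hΛ, ← hr.avg] at h1 h2
  have hrhs : ∑ t ∈ Finset.Icc 1 T, lam t / Λ * e t = (∑ t ∈ Finset.Icc 1 T, lam t * e t) / Λ := by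
    rw [Finset.sum_div]
    exact Finset.sum_congr rfl fun t _ => by ring
  rw [hrhs]
  refine le_of_mul_le_mul_left ?_ hΛ0
  have h3 : Λ * (((T + 1 : ℝ) * (T + 2) * η) / (T * (T + 3)) *
      (prox ω gradω x v - prox ω gradω xout v) -
        η / 2 * p (xhat - x) ^ 2 + (∑ t ∈ Finset.Icc 1 T, lam t * e t) / Λ) =
      η * ((T + 1) * (T + 2) / 2) * (prox ω gradω x v - prox ω gradω xout v) -
        η / 2 * (Λ * p (xhat - x) ^ 2) + ∑ t ∈ Finset.Icc 1 T, lam t * e t := by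
    rw [mul_add, mul_div_cancel₀ _ hΛ0.ne', hΛe]
    field_simp
  rw [h3]
  -- `Λ + 1 = (T + 1)(T + 2) / 2`. The extra `1` is the initial telescoped term, since `u 0 = x`.
  have h4 : Λ * (η * prox ω gradω x v) + η * prox ω gradω x v =
      η * ((T + 1) * (T + 2) / 2) * prox ω gradω x v := by
    rw [hΛe]; ring
  have h5 := mul_le_mul_of_nonneg_left h2 (by positivity : 0 ≤ η / 2)
  linarith

end InnerLoop

/-! ### The outer loop -/

section OuterLoop

variable {E : Type*} [NormedAddCommGroup E] [InnerProductSpace ℝ E]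

lemma two_inner_sub_eq (a b c : E) :
    2 * ⟪a - b, c - a⟫ = ‖c - b‖ ^ 2 - ‖c - a‖ ^ 2 - ‖a - b‖ ^ 2 := by
  have : c - b = (c - a) + (a - b) := by abel
  rw [this, norm_add_sq_real, real_inner_comm]
  ring

/-- Young's inequality; `θ ℓ² ≤ κ η` is exactly what makes the two quadratic coefficients large
enough. -/
lemma mul_inner_le {θ B ℓ r η κ : ℝ} {a b : E} (hθ : 0 < θ) (hη : 0 < η)
    (ha : ‖a‖ ≤ ℓ * r) (hB : θ * ℓ ^ 2 ≤ B * η) (hκ : B = κ) :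
    θ * ⟪a, b⟫ ≤ θ * η / 2 * r ^ 2 + κ / 2 * ‖b‖ ^ 2 := by
  subst hκ
  have h1 : ⟪a, b⟫ ≤ ℓ * r * ‖b‖ :=
    (real_inner_le_norm a b).trans (mul_le_mul_of_nonneg_right ha (norm_nonneg _))
  have h2 : θ * ⟪a, b⟫ ≤ θ * (ℓ * r * ‖b‖) := mul_le_mul_of_nonneg_left h1 hθ.le
  refine h2.trans ?_
  have h3 : θ * ℓ ^ 2 * ‖b‖ ^ 2 ≤ B * η * ‖b‖ ^ 2 :=
    mul_le_mul_of_nonneg_right hB (sq_nonneg _)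
  refine le_of_mul_le_mul_left ?_ hη
  nlinarith [mul_nonneg hθ.le (sq_nonneg (η * r - ℓ * ‖b‖))]

/-- The primal-dual recursion of the outer loop, with the dual step size `θ τ` constant. -/
lemma primal_dual_sum_le {N : ℕ} {α θ η τ A V r φ e : ℕ → ℝ} {ℓ κ : ℝ}
    {y D Lx Lxt : ℕ → E} (hθ : ∀ k ∈ Finset.Icc 1 N, 0 < θ k) (hη : ∀ k ∈ Finset.Icc 1 N, 0 < η k)
    (hκ : 0 < κ)
    (hτ : ∀ k ∈ Finset.Icc 1 N, θ k * τ k = κ)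
    (hα : ∀ k ∈ Finset.Icc 2 N, α k * θ k = θ (k - 1))
    (hαℓ : ∀ k ∈ Finset.Icc 2 N, α k * ℓ ^ 2 ≤ η (k - 1) * τ k)
    (hN : θ N * ℓ ^ 2 ≤ κ * η N) (hV : ∀ k ∈ Finset.Icc 1 N, 0 ≤ V k)
    (hA : ∀ k ∈ Finset.Icc 1 N, 0 ≤ A k)
    (hAθ : ∀ k ∈ Finset.Icc 2 N, θ k * A k ≤ θ (k - 1) * A (k - 1))
    (hD0 : D 0 = 0) (hD : ∀ k ∈ Finset.Icc 1 N, ‖D k‖ ≤ ℓ * r k)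
    (hLxt : ∀ k ∈ Finset.Icc 1 N, Lx k - Lxt k = D k - α k • D (k - 1))
    (hy : ∀ k ∈ Finset.Icc 1 N, τ k • (y k - y (k - 1)) = Lxt k)
    (hφ : ∀ k ∈ Finset.Icc 1 N, φ k + ⟪Lx k, y k⟫ ≤
      A k * (V (k - 1) - V k) - η k / 2 * r k ^ 2 + e k)
    (h1N : 1 ≤ N) (ybar : E) :
    ∑ k ∈ Finset.Icc 1 N, θ k * (φ k + ⟪Lx k, ybar⟫) ≤
      θ 1 * A 1 * V 0 + κ / 2 * ‖y 0‖ ^ 2 + ∑ k ∈ Finset.Icc 1 N, θ k * e k +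
        ⟪θ N • D N + κ • (y N - y 0), ybar⟫ := by
  -- Substituting `Lx k = D k - α k • D (k - 1) + τ k • (y k - y (k - 1))` makes the `D`-terms
  -- telescope, as `α k * θ k = θ (k - 1)`. Only the cross term of `D (k - 1)` with `y k - y (k -
  -- 1)` is left over.
  have hstep : ∀ k ∈ Finset.Icc 1 N, θ k * (φ k + ⟪Lx k, ybar⟫) ≤
      θ k * A k * (V (k - 1) - V k) - θ k * η k / 2 * r k ^ 2 + θ k * e k +
        κ / 2 * (‖ybar - y (k - 1)‖ ^ 2 - ‖ybar - y k‖ ^ 2 - ‖y k - y (k - 1)‖ ^ 2) +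
        θ k * ⟪D k, ybar - y k⟫ - α k * θ k * ⟪D (k - 1), ybar - y (k - 1)⟫ +
        α k * θ k * ⟪D (k - 1), y k - y (k - 1)⟫ := by
    intro k hk
    have h1 := mul_le_mul_of_nonneg_left (hφ k hk) (hθ k hk).le
    have h2 : ⟪Lx k, ybar⟫ = ⟪Lx k, y k⟫ + ⟪D k, ybar - y k⟫ - α k * ⟪D (k - 1), ybar - y k⟫ +
        τ k * ⟪y k - y (k - 1), ybar - y k⟫ := by
      have h3 : Lx k = (D k - α k • D (k - 1)) + τ k • (y k - y (k - 1)) := by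
        rw [hy k hk, ← hLxt k hk]; abel
      have h4 : ⟪Lx k, ybar⟫ = ⟪Lx k, y k⟫ + ⟪Lx k, ybar - y k⟫ := by
        rw [← inner_add_right]; congr 1; abel
      rw [h4]
      conv_lhs => rw [h3]
      conv_rhs => rw [h3]
      simp only [inner_add_left, inner_sub_left, inner_smul_left, RCLike.conj_to_real]
      ring
    have h5 : ⟪D (k - 1), ybar - y k⟫ =
        ⟪D (k - 1), ybar - y (k - 1)⟫ - ⟪D (k - 1), y k - y (k - 1)⟫ := by
      rw [← inner_sub_right]; congr 1; abel
    have h6 := two_inner_sub_eq (y k) (y (k - 1)) ybar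
    have h7 : θ k * (τ k * ⟪y k - y (k - 1), ybar - y k⟫) = κ / 2 * (‖ybar - y (k - 1)‖ ^ 2 -
        ‖ybar - y k‖ ^ 2 - ‖y k - y (k - 1)‖ ^ 2) := by
      rw [← mul_assoc, hτ k hk, ← h6]; ring
    rw [h2, h5]
    linarith
  -- The invariant keeps `-θ n * η n / 2 * r n ^ 2` unspent, because it pays for the cross term of
  -- step `n + 1`.
  have key : ∀ n, 1 ≤ n → n ≤ N → ∑ k ∈ Finset.Icc 1 n, θ k * (φ k + ⟪Lx k, ybar⟫) ≤
      θ 1 * A 1 * V 0 - θ n * A n * V n - θ n * η n / 2 * r n ^ 2 +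
        ∑ k ∈ Finset.Icc 1 n, θ k * e k + κ / 2 * (‖ybar - y 0‖ ^ 2 - ‖ybar - y n‖ ^ 2) +
        θ n * ⟪D n, ybar - y n⟫ := by
    intro n hn
    induction n, hn using Nat.le_induction with
    | base =>
      intro hN'
      have h1 := hstep 1 (Finset.mem_Icc.2 ⟨le_rfl, hN'⟩)
      simp only [Nat.sub_self, hD0, inner_zero_left, mul_zero] at h1
      simp only [Finset.Icc_self, Finset.sum_singleton]
      nlinarith [sq_nonneg ‖y 1 - y 0‖]
    | succ n hn ih =>
      intro hN'
      have ih := ih (by omega)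
      have hn1 : n ∈ Finset.Icc 1 N := Finset.mem_Icc.2 ⟨hn, by omega⟩
      have hk1 : n + 1 ∈ Finset.Icc 1 N := Finset.mem_Icc.2 ⟨by omega, hN'⟩
      have hk2 : n + 1 ∈ Finset.Icc 2 N := Finset.mem_Icc.2 ⟨by omega, hN'⟩
      have h1 := hstep (n + 1) hk1
      have h2 := hα _ hk2
      have h3 := hαℓ _ hk2
      have h4 := hAθ _ hk2
      rw [h2] at h1
      simp only [Nat.add_sub_cancel] at h1 h2 h3 h4
      rw [Finset.sum_Icc_succ_top (by omega), Finset.sum_Icc_succ_top (by omega)]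
      have h5 : θ n * ℓ ^ 2 ≤ κ * η n := by
        rw [← h2, ← hτ _ hk1]
        nlinarith [mul_le_mul_of_nonneg_left h3 (hθ _ hk1).le]
      have h6 := mul_inner_le (b := y (n + 1) - y n) (hθ n hn1) (hη n hn1) (hD n hn1) h5 rfl
      have h7 := mul_le_mul_of_nonneg_right h4 (hV n hn1)
      linarith
  have h1 := key N h1N le_rfl
  have hNN : N ∈ Finset.Icc 1 N := Finset.mem_Icc.2 ⟨h1N, le_rfl⟩
  -- The last unspent quadratic, with the `-κ / 2 * ‖y N‖ ^ 2` from expanding the squares, absorbs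
  -- `-⟪D N, y N⟫`. The two copies of `‖ybar‖ ^ 2` cancel, leaving an expression affine in `ybar`.
  have h2 := mul_inner_le (b := -y N) (hθ N hNN) (hη N hNN) (hD N hNN) hN rfl
  rw [norm_neg, inner_neg_right] at h2
  have h3 : 0 ≤ θ N * A N * V N := mul_nonneg (mul_nonneg (hθ N hNN).le (hA N hNN)) (hV N hNN)
  have h4 := norm_sub_sq_real ybar (y 0)
  have h5 := norm_sub_sq_real ybar (y N)
  have h6 : ⟪θ N • D N + κ • (y N - y 0), ybar⟫ =
      θ N * ⟪D N, ybar⟫ + κ * (⟪ybar, y N⟫ - ⟪ybar, y 0⟫) := by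
    simp only [inner_add_left, inner_smul_left, inner_sub_left, RCLike.conj_to_real]
    rw [real_inner_comm ybar (y N), real_inner_comm ybar (y 0)]
  rw [h6]
  rw [h4, h5, inner_sub_right] at h1
  linarith

end OuterLoop

/-! ### The gap along one realization of the algorithm -/

/-- The sequence `θ k * τ k` is nonincreasing and has equal ends. -/
lemma Params.Admissible.θ_mul_τ {c : Params} {ℓ : ℝ} {N : ℕ} (hc : c.Admissible ℓ N) :
    ∀ k ∈ Finset.Icc 1 N, c.θ k * c.τ k = c.θ 1 * c.τ 1 := by
  have key : ∀ a b, 1 ≤ a → a ≤ b → b ≤ N → c.θ b * c.τ b ≤ c.θ a * c.τ a := by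
    intro a b ha hab
    induction b, hab using Nat.le_induction with
    | base => exact fun _ => le_rfl
    | succ n hn ih =>
      intro hN
      exact (hc.θ_τ (n + 1) (Finset.mem_Icc.2 ⟨by omega, hN⟩)).trans (ih (by omega))
  intro k hk
  obtain ⟨h1, h2⟩ := Finset.mem_Icc.1 hk
  refine le_antisymm (key 1 k le_rfl h1 h2) ?_
  rw [hc.θ_τ_ends]
  exact key k N h1 h2 le_rfl

lemma Params.Admissible.sum_lam {c : Params} {ℓ : ℝ} {N : ℕ} (hc : c.Admissible ℓ N) (T : ℕ) :
    ∑ t ∈ Finset.Icc 1 T, c.lam t = T * (T + 3) / 2 := by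
  rw [← sum_Icc_add_one]
  exact Finset.sum_congr rfl fun t ht => hc.lam_eq t (Finset.mem_Icc.1 ht).1

lemma Params.Admissible.sum_lam_pos {c : Params} {ℓ : ℝ} {N : ℕ} (hc : c.Admissible ℓ N) {T : ℕ}
    (hT : 1 ≤ T) : 0 < ∑ t ∈ Finset.Icc 1 T, c.lam t := by
  rw [hc.sum_lam]
  have : (0 : ℝ) < T := by exact_mod_cast hT
  positivity

/-- As `(t + 1) / t ≤ 2`, each of the `T` terms is at most `8 / (T (T + 3))`. -/
lemma Params.Admissible.sum_lam_div_le {c : Params} {ℓ : ℝ} {N : ℕ} (hc : c.Admissible ℓ N) {T : ℕ}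
    (hT : 1 ≤ T) :
    ∑ t ∈ Finset.Icc 1 T, c.lam t / ((∑ s ∈ Finset.Icc 1 T, c.lam s) * c.β t) ≤ 8 / (T + 3) := by
  have hT0 : (0 : ℝ) < T := by exact_mod_cast hT
  have h1 : ∀ t ∈ Finset.Icc 1 T, c.lam t / ((∑ s ∈ Finset.Icc 1 T, c.lam s) * c.β t) ≤
      8 / (T * (T + 3)) := by
    intro t ht
    have ht1 := (Finset.mem_Icc.1 ht).1
    have ht0 : (1 : ℝ) ≤ t := by exact_mod_cast ht1
    rw [hc.sum_lam, hc.lam_eq t ht1, hc.β_eq t ht1, div_le_div_iff₀ (by positivity) (by positivity)]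
    have h3 : (0 : ℝ) < T * (T + 3) := by positivity
    nlinarith
  refine (Finset.sum_le_sum h1).trans (le_of_eq ?_)
  rw [Finset.sum_const, Nat.card_Icc, nsmul_eq_mul, Nat.add_sub_cancel]
  field_simp

lemma Params.Admissible.sum_θ_pos {c : Params} {ℓ : ℝ} {N : ℕ} (hc : c.Admissible ℓ N)
    (hN : 1 ≤ N) : 0 < ∑ k ∈ Finset.Icc 1 N, c.θ k :=
  Finset.sum_pos hc.θ_pos ⟨1, Finset.mem_Icc.2 ⟨le_rfl, hN⟩⟩

section Run

variable {m d : ℕ} {G : SimpleGraph (Fin m)} [DecidableRel G.Adj] {X : Fin m → Set (Vec d)}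
  {p : Fin m → Seminorm ℝ (Vec d)} {ω : Fin m → Vec d → ℝ} {gradω : Fin m → Vec d → Vec d}
  {f : Fin m → Vec d → ℝ} {f' : Fin m → Vec d → Vec d} {M : ℝ} {xs x0 y0 : Stack m d}
  {c : Params} {N : ℕ} {H : Fin m → ℕ → ℕ → Vec d → Vec d} {z : Iterates m d}

lemma IsSDCSRun.x_mem (hz : IsSDCSRun G X ω gradω c N x0 y0 H z) (hx0 : ∀ i, x0 i ∈ X i)
    (hT : ∀ k ∈ Finset.Icc 1 N, 1 ≤ c.T k) {k : ℕ} (hk : k ≤ N) (i : Fin m) : z.x k i ∈ X i := by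
  rcases Nat.eq_zero_or_pos k with rfl | h0
  · rw [hz.x_zero]; exact hx0 i
  · have hk' : k ∈ Finset.Icc 1 N := Finset.mem_Icc.2 ⟨h0, hk⟩
    rw [(hz.slide k hk' i).out]
    exact (hz.slide k hk' i).mem _ (Finset.mem_Icc.2 ⟨hT k hk', le_rfl⟩)

lemma IsSDCSRun.u_mem (hz : IsSDCSRun G X ω gradω c N x0 y0 H z) (hx0 : ∀ i, x0 i ∈ X i)
    (hT : ∀ k ∈ Finset.Icc 1 N, 1 ≤ c.T k) {k t : ℕ} (hk : k ∈ Finset.Icc 1 N) (ht : t ≤ c.T k)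
    (i : Fin m) : z.u k t i ∈ X i := by
  rcases Nat.eq_zero_or_pos t with rfl | h0
  · rw [(hz.slide k hk i).init]
    exact hz.x_mem hx0 hT (by have := (Finset.mem_Icc.1 hk).2; omega) i
  · exact (hz.slide k hk i).mem t (Finset.mem_Icc.2 ⟨h0, ht⟩)

/-- The error of the oracle call by agent `i` at inner index `t` of outer iteration `k`. -/
def oracleError (H : Fin m → ℕ → ℕ → Vec d → Vec d) (f' : Fin m → Vec d → Vec d)
    (z : Iterates m d) (i : Fin m) (k t : ℕ) : Vec d :=
  H i k t (z.u k t i) - f' i (z.u k t i)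

/-- The contribution of outer iteration `k` to the error terms. -/
noncomputable def stageError (p : Fin m → Seminorm ℝ (Vec d)) (c : Params) (M : ℝ)
    (xs : Stack m d) (H : Fin m → ℕ → ℕ → Vec d → Vec d) (f' : Fin m → Vec d → Vec d)
    (z : Iterates m d) (k : ℕ) : ℝ :=
  ∑ i, ∑ t ∈ Finset.Icc 1 (c.T k), c.lam t / (∑ s ∈ Finset.Icc 1 (c.T k), c.lam s) *
    ((M ^ 2 + dualNorm (p i) (oracleError H f' z i k (t - 1)) ^ 2) / (c.η k * c.β t) +
      ⟪oracleError H f' z i k (t - 1), xs i - z.u k (t - 1) i⟫)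

lemma IsSDCSRun.sum_gapQ_le (hz : IsSDCSRun G X ω gradω c N x0 y0 H z)
    (hXconv : ∀ i, Convex ℝ (X i)) (hp : ∀ i x, p i x = 0 → x = 0)
    (hω : ∀ i, IsDistGen (p i) (X i) 1 (ω i) (gradω i)) (hf : ∀ i, ConvexOn ℝ (X i) (f i))
    (hf' : ∀ i, ∀ x ∈ X i, ∀ y ∈ X i,
      0 ≤ f i x - f i y - ⟪f' i y, x - y⟫ ∧ f i x - f i y - ⟪f' i y, x - y⟫ ≤ M * p i (x - y))
    (hxs : xs ∈ feasibleSet G X) (hN : 1 ≤ N) (hc : c.Admissible (lapNorm G p) N)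
    (hx0 : ∀ i, x0 i ∈ X i) (ybar : Stack m d) :
    ∑ k ∈ Finset.Icc 1 N, c.θ k *
        (objective f (z.xhat k) - objective f xs + ⟪lapOp d G (z.xhat k), ybar⟫) ≤
      c.θ 1 * (((c.T 1 + 1 : ℝ) * (c.T 1 + 2) * c.η 1) / (c.T 1 * (c.T 1 + 3))) *
        stackProx ω gradω x0 xs + c.θ 1 * c.τ 1 / 2 * ‖y0‖ ^ 2 +
        ∑ k ∈ Finset.Icc 1 N, c.θ k * stageError p c M xs H f' z k +
        ⟪c.θ N • lapOp d G (z.xhat N - z.x (N - 1)) + (c.θ 1 * c.τ 1) • (z.y N - z.y 0), ybar⟫ := by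
  have h1 : 1 ∈ Finset.Icc 1 N := Finset.mem_Icc.2 ⟨le_rfl, hN⟩
  have hx : ∀ k ≤ N, ∀ i, z.x k i ∈ X i := fun k hk i => hz.x_mem hx0 hc.T_pos hk i
  have hVnn : ∀ k ≤ N, 0 ≤ stackProx ω gradω (z.x k) xs := fun k hk =>
    Finset.sum_nonneg fun i _ => (hω i).prox_nonneg (hXconv i) (hx k hk i) (hxs.2 i)
  have key := primal_dual_sum_le (E := Stack m d) (N := N) (α := c.α) (θ := c.θ) (η := c.η)
    (τ := c.τ) (A := fun k => ((c.T k + 1 : ℝ) * (c.T k + 2) * c.η k) / (c.T k * (c.T k + 3)))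
    (V := fun k => stackProx ω gradω (z.x k) xs)
    (r := fun k => primalNorm p (z.xhat k - z.x (k - 1)))
    (φ := fun k => objective f (z.xhat k) - objective f xs)
    (e := stageError p c M xs H f' z)
    (ℓ := lapNorm G p) (κ := c.θ 1 * c.τ 1) (y := z.y)
    (D := fun k => lapOp d G (z.xhat k - z.x (k - 1)))
    (Lx := fun k => lapOp d G (z.xhat k)) (Lxt := fun k => lapOp d G (z.xt k))
    hc.θ_pos hc.η_pos (mul_pos (hc.θ_pos 1 h1) (hc.τ_pos 1 h1)) hc.θ_mul_τ hc.α_θ hc.α_norm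
    hc.θ_norm (fun k hk => hVnn k (Finset.mem_Icc.1 hk).2) ?_ hc.θ_η_T ?_ ?_ ?_ ?_ ?_ hN ybar
  · simpa only [hz.x_zero, hz.y_zero] using key
  · intro k hk
    have := hc.η_pos k hk
    positivity
  -- Here `0 - 1` truncates to `0`, so the difference at index `0` is `x0 - x0`.
  · simp only [Nat.zero_sub, hz.x_zero, hz.xhat_zero, sub_self]
    exact (lapLin G d).map_zero
  · exact fun k _ => norm_lapOp_le G hp _
  · intro k hk
    simp only [hz.predict k hk, ← lapLin_apply, map_add, map_sub, map_smul, Nat.sub_sub,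
      Nat.reduceAdd]
    abel
  · intro k hk
    rw [hz.dual k hk, add_sub_cancel_left, smul_smul, mul_one_div_cancel (hc.τ_pos k hk).ne',
      one_smul, hz.disagree k hk]
  · intro k hk
    have hkN := Finset.mem_Icc.1 hk
    have hrun : ∀ i, _ := fun i => (hz.slide k hk i).average_le (hω i) (hXconv i) (hp i) (hf i)
      (hf' i) (hc.T_pos k hk) (hc.η_pos k hk) hc.lam_eq hc.β_eq (hx (k - 1) (by omega) i)
      (hxs.2 i)
    have hsum := Finset.sum_le_sum fun i (_ : i ∈ Finset.univ) => hrun i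
    -- The local terms add up to the coupling term because `𝐋` is symmetric and annihilates `xs`.
    have hw : ⟪lapOp d G (z.xhat k), z.y k⟫ = ∑ i, ⟪z.w k i, z.xhat k i - xs i⟫ := by
      have h2 : ∑ i, ⟪z.w k i, z.xhat k i - xs i⟫ = ⟪z.w k, z.xhat k - xs⟫ := by
        rw [PiLp.inner_apply]
        rfl
      have h3 : lapOp d G (z.xhat k - xs) = lapOp d G (z.xhat k) := by
        have h4 := hxs.1
        rw [← lapLin_apply] at h4 ⊢
        rw [map_sub, h4, sub_zero, lapLin_apply]
      rw [h2, hz.dual_comm k hk, inner_lapOp_left G (z.y k), h3, real_inner_comm]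
    simp only [hw, primalNorm_sq, stackProx, objective, stageError]
    simp only [Finset.sum_add_distrib, Finset.sum_sub_distrib, ← Finset.mul_sum, mul_sub] at hsum ⊢
    simp only [oracleError, PiLp.sub_apply]
    linarith

/-- The sum of the martingale difference terms. -/
noncomputable def noiseLin (c : Params) (N : ℕ) (xs : Stack m d)
    (H : Fin m → ℕ → ℕ → Vec d → Vec d) (f' : Fin m → Vec d → Vec d) (z : Iterates m d) : ℝ :=
  ∑ k ∈ Finset.Icc 1 N, ∑ t ∈ Finset.Icc 1 (c.T k), ∑ i : Fin m,
    c.θ k * c.lam t / (∑ s ∈ Finset.Icc 1 (c.T k), c.lam s) *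
      ⟪oracleError H f' z i k (t - 1), xs i - z.u k (t - 1) i⟫

/-- The sum of the quadratic error terms. -/
noncomputable def noiseQuad (p : Fin m → Seminorm ℝ (Vec d)) (c : Params) (N : ℕ)
    (H : Fin m → ℕ → ℕ → Vec d → Vec d) (f' : Fin m → Vec d → Vec d) (z : Iterates m d) : ℝ :=
  ∑ k ∈ Finset.Icc 1 N, ∑ t ∈ Finset.Icc 1 (c.T k), ∑ i : Fin m,
    c.θ k * c.lam t / ((∑ s ∈ Finset.Icc 1 (c.T k), c.lam s) * c.η k * c.β t) *
      dualNorm (p i) (oracleError H f' z i k (t - 1)) ^ 2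

/-- The second sum in `B_p(N)`. -/
noncomputable def quadBound (m : ℕ) (c : Params) (N : ℕ) (σ : ℝ) : ℝ :=
  ∑ k ∈ Finset.Icc 1 N, ∑ t ∈ Finset.Icc 1 (c.T k), ∑ _i : Fin m,
    σ ^ 2 * c.θ k * c.lam t / ((∑ s ∈ Finset.Icc 1 (c.T k), c.lam s) * c.η k * c.β t)

/-- Adding `quadBound` puts `σ²` beside `M²`, whose total weight `sum_lam_div_le` controls; the
random quadratic part is thereby compared with its typical size `quadBound`. -/
lemma sum_stageError_add_le {ℓ σ : ℝ} (hc : c.Admissible ℓ N) :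
    ∑ k ∈ Finset.Icc 1 N, c.θ k * stageError p c M xs H f' z k + quadBound m c N σ ≤
      ∑ k ∈ Finset.Icc 1 N, 8 * m * (M ^ 2 + σ ^ 2) * c.θ k / (c.η k * (c.T k + 3)) +
        (noiseLin c N xs H f' z + noiseQuad p c N H f' z) := by
  simp only [noiseLin, noiseQuad, quadBound, ← Finset.sum_add_distrib]
  refine Finset.sum_le_sum fun k hk => ?_
  have hη := hc.η_pos k hk
  have hθ := hc.θ_pos k hk
  have h1 := mul_le_mul_of_nonneg_left (hc.sum_lam_div_le (hc.T_pos k hk))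
    (by positivity : 0 ≤ m * (M ^ 2 + σ ^ 2) * c.θ k / c.η k)
  have h2 : m * (M ^ 2 + σ ^ 2) * c.θ k / c.η k * (8 / (c.T k + 3)) =
      8 * m * (M ^ 2 + σ ^ 2) * c.θ k / (c.η k * (c.T k + 3)) := by
    field_simp
  rw [h2] at h1
  refine le_trans (le_of_eq ?_) (add_le_add_left h1 _)
  simp only [stageError, Finset.mul_sum]
  rw [Finset.sum_comm, ← Finset.sum_add_distrib, ← Finset.sum_add_distrib]
  refine Finset.sum_congr rfl fun t ht => ?_
  have h3 : m * (M ^ 2 + σ ^ 2) * c.θ k / c.η k *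
      (c.lam t / ((∑ s ∈ Finset.Icc 1 (c.T k), c.lam s) * c.β t)) =
      ∑ _i : Fin m, (M ^ 2 + σ ^ 2) * c.θ k / c.η k *
        (c.lam t / ((∑ s ∈ Finset.Icc 1 (c.T k), c.lam s) * c.β t)) := by
    rw [Finset.sum_const, Finset.card_univ, Fintype.card_fin, nsmul_eq_mul]
    ring
  rw [h3]
  simp only [← Finset.sum_add_distrib]
  refine Finset.sum_congr rfl fun i _ => ?_
  have hβ : c.β t ≠ 0 := by
    have ht1 := (Finset.mem_Icc.1 ht).1
    have : (0 : ℝ) < t := by exact_mod_cast ht1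
    rw [hc.β_eq t ht1]
    positivity
  have hΛ := (hc.sum_lam_pos (hc.T_pos k hk)).ne'
  field_simp
  ring

/-- The perturbed gap is at most `B_d(N)` plus the fluctuations of the error terms. -/
lemma IsSDCSRun.perturbedGap_le (hz : IsSDCSRun G X ω gradω c N x0 y0 H z)
    (hXconv : ∀ i, Convex ℝ (X i)) (hp : ∀ i x, p i x = 0 → x = 0)
    (hω : ∀ i, IsDistGen (p i) (X i) 1 (ω i) (gradω i)) (hf : ∀ i, ConvexOn ℝ (X i) (f i))
    (hf' : ∀ i, ∀ x ∈ X i, ∀ y ∈ X i,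
      0 ≤ f i x - f i y - ⟪f' i y, x - y⟫ ∧ f i x - f i y - ⟪f' i y, x - y⟫ ≤ M * p i (x - y))
    (hxs : xs ∈ feasibleSet G X) (hN : 1 ≤ N) (hc : c.Admissible (lapNorm G p) N)
    (hx0 : ∀ i, x0 i ∈ X i) (σ : ℝ) :
    perturbedGap G f xs (z.vHat G c N) (z.xAvg c N) (z.yAvg c N) ≤
      ((boundD c N M σ (stackProx ω gradω x0 xs) y0 + (∑ k ∈ Finset.Icc 1 N, c.θ k)⁻¹ *
        (noiseLin c N xs H f' z + noiseQuad p c N H f' z - quadBound m c N σ) : ℝ) : EReal) := by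
  refine iSup_le fun ybar => EReal.coe_le_coe_iff.2 ?_
  have hW := hc.sum_θ_pos hN
  have hθ0 : ∀ k ∈ Finset.Icc 1 N, 0 ≤ c.θ k := fun k hk => (hc.θ_pos k hk).le
  set W := ∑ k ∈ Finset.Icc 1 N, c.θ k with hWdef
  have hxhat : ∀ k ∈ Finset.Icc 1 N, ∀ i, z.xhat k i ∈ X i := by
    intro k hk i
    rw [(hz.slide k hk i).avg]
    refine average_mem (hXconv i) (fun t ht => ?_) (hc.sum_lam_pos (hc.T_pos k hk))
      (hz.slide k hk i).mem
    rw [hc.lam_eq t (Finset.mem_Icc.1 ht).1]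
    positivity
  have havg : ∀ i, z.xAvg c N i = W⁻¹ • ∑ k ∈ Finset.Icc 1 N, c.θ k • z.xhat k i := by
    intro i
    simp [Iterates.xAvg, hWdef]
  have hobj : W * objective f (z.xAvg c N) ≤
      ∑ k ∈ Finset.Icc 1 N, c.θ k * objective f (z.xhat k) := by
    simp only [objective, Finset.mul_sum]
    rw [Finset.sum_comm]
    refine Finset.sum_le_sum fun i _ => ?_
    rw [havg i]
    exact mul_map_average_le (hf i) hθ0 hW (fun k hk => hxhat k hk i)
  have hlin : W * ⟪lapOp d G (z.xAvg c N), ybar⟫ =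
      ∑ k ∈ Finset.Icc 1 N, c.θ k * ⟪lapOp d G (z.xhat k), ybar⟫ := by
    rw [Iterates.xAvg, ← lapLin_apply, map_smul, inner_smul_left, map_sum, sum_inner, ← hWdef,
      RCLike.conj_to_real, ← mul_assoc, mul_inv_cancel₀ hW.ne', one_mul]
    refine Finset.sum_congr rfl fun k _ => ?_
    rw [map_smul, inner_smul_left, lapLin_apply, RCLike.conj_to_real]
  have hv : W * ⟪z.vHat G c N, ybar⟫ = ⟪c.θ N • lapOp d G (z.xhat N - z.x (N - 1)) +
      (c.θ 1 * c.τ 1) • (z.y N - z.y 0), ybar⟫ := by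
    rw [Iterates.vHat, inner_smul_left, ← hWdef, RCLike.conj_to_real, ← mul_assoc,
      mul_inv_cancel₀ hW.ne', one_mul]
  have h1 := hz.sum_gapQ_le hXconv hp hω hf hf' hxs hN hc hx0 ybar
  have h2 := sum_stageError_add_le (p := p) (M := M) (xs := xs) (H := H) (f' := f') (z := z)
    (σ := σ) hc
  have hsplit : ∑ k ∈ Finset.Icc 1 N, c.θ k *
        (objective f (z.xhat k) - objective f xs + ⟪lapOp d G (z.xhat k), ybar⟫) =
      ∑ k ∈ Finset.Icc 1 N, c.θ k * objective f (z.xhat k) - W * objective f xs +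
        ∑ k ∈ Finset.Icc 1 N, c.θ k * ⟪lapOp d G (z.xhat k), ybar⟫ := by
    rw [hWdef, Finset.sum_mul, ← Finset.sum_sub_distrib, ← Finset.sum_add_distrib]
    exact Finset.sum_congr rfl fun k _ => by ring
  rw [hsplit, ← hlin, ← hv] at h1
  refine le_of_mul_le_mul_left ?_ hW
  rw [boundD, ← hWdef, mul_add, ← mul_assoc, ← mul_assoc, mul_inv_cancel₀ hW.ne', one_mul, one_mul,
    gapQ, hxs.1, inner_zero_left]
  have h3 : c.θ 1 * (((c.T 1 + 1 : ℝ) * (c.T 1 + 2) * c.η 1) / (c.T 1 * (c.T 1 + 3))) =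
      ((c.T 1 + 1 : ℝ) * (c.T 1 + 2) * c.θ 1 * c.η 1) / (c.T 1 * (c.T 1 + 3)) := by ring
  rw [h3] at h1
  linarith

end Run

/-! ### Exponential moments -/

/-- For `x ≤ 0` one has `exp x ≤ 1 + x + x² / 2`, since `(1 + x + x²/2)(1 - x + x²/2) = 1 + x⁴/4`.
For `x ≥ 16/9` the exponents already compare. In between, Taylor polynomials are compared. -/
lemma exp_le_add_exp_sq (x : ℝ) : Real.exp x ≤ x + Real.exp (9 * x ^ 2 / 16) := by
  rcases le_total x 0 with hx | hx
  · have h1 : Real.exp x ≤ 1 + x + x ^ 2 / 2 := by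
      have h2 := Real.quadratic_le_exp_of_nonneg (neg_nonneg.2 hx)
      have h3 : Real.exp x * Real.exp (-x) = 1 := by rw [← Real.exp_add]; simp
      have h4 : 0 < Real.exp x := Real.exp_pos x
      have h5 := mul_le_mul_of_nonneg_left h2 h4.le
      rw [h3] at h5
      have h6 : 0 < 1 - x + x ^ 2 / 2 := by nlinarith
      refine le_of_mul_le_mul_right ?_ h6
      nlinarith [sq_nonneg (x ^ 2)]
    have h2 := Real.add_one_le_exp (9 * x ^ 2 / 16)
    nlinarith
  rcases le_total (16 / 9) x with hx' | hx'
  · have : Real.exp x ≤ Real.exp (9 * x ^ 2 / 16) := Real.exp_le_exp.2 (by nlinarith)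
    linarith
  -- Halving the argument brings it below `1`, where the Taylor remainder estimate applies.
  · have h1 : Real.exp (x / 2) ≤ 1 + x / 2 + x ^ 2 / 8 + x ^ 3 / 48 + x ^ 4 / 384 + x ^ 5 / 3200 := by
      have := Real.exp_bound' (x := x / 2) (by positivity) (by linarith) (n := 5) (by norm_num)
      simp only [Finset.sum_range_succ, Finset.sum_range_zero, Nat.factorial] at this
      norm_num at this
      nlinarith [this]
    have h2 : Real.exp x ≤
        (1 + x / 2 + x ^ 2 / 8 + x ^ 3 / 48 + x ^ 4 / 384 + x ^ 5 / 3200) ^ 2 := by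
      have h3 : Real.exp x = Real.exp (x / 2) ^ 2 := by
        rw [sq, ← Real.exp_add]; ring_nf
      rw [h3]
      exact pow_le_pow_left₀ (Real.exp_pos _).le h1 2
    have h4 : 1 + 9 * x ^ 2 / 16 + (9 * x ^ 2 / 16) ^ 2 / 2 + (9 * x ^ 2 / 16) ^ 3 / 6 ≤ Real.exp (9 * x ^ 2 / 16) := by
      have := Real.sum_le_exp_of_nonneg (x := 9 * x ^ 2 / 16) (by positivity) 4
      simp only [Finset.sum_range_succ, Finset.sum_range_zero, Nat.factorial] at this
      norm_num at this
      linarith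
    refine h2.trans (le_trans ?_ (add_le_add_right h4 x))
    have g3 : x ^ 7 ≤ 2 * x ^ 6 := by nlinarith [pow_nonneg hx 6]
    have g4 : x ^ 8 ≤ 2 * x ^ 7 := by nlinarith [pow_nonneg hx 7]
    have g5 : x ^ 9 ≤ 2 * x ^ 8 := by nlinarith [pow_nonneg hx 8]
    have g6 : x ^ 10 ≤ 2 * x ^ 9 := by nlinarith [pow_nonneg hx 9]
    -- `g7` accounts exactly for the quadratic and cubic coefficients of the difference, and the
    -- cross term of `g8` for the quintic one.
    have g7 : 0 ≤ x ^ 2 * (1 / 4 - x / 3) ^ 2 := by positivity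
    have g8 : 0 ≤ x ^ 4 * (3 / 50 * x - 9 / 128) ^ 2 := by positivity
    have g9 : 0 ≤ x ^ 4 := by positivity
    have g10 : 0 ≤ x ^ 6 := by positivity
    linarith

section Probability

variable {Ω : Type*} [MeasurableSpace Ω] {P : Measure Ω}

/-- A pointwise form of Jensen's `E exp(a r) ≤ (E exp r)^a`, linear in `exp r`: if `E exp r ≤ e`,
the bracket has mean at most `1`. -/
lemma exp_mul_le {a : ℝ} (ha : 0 ≤ a) (ha1 : a ≤ 1) (r : ℝ) :
    Real.exp (a * r) ≤ Real.exp a * (a * (Real.exp (-1) * Real.exp r) + (1 - a)) := by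
  have h := convexOn_exp.2 (Set.mem_univ (r - 1)) (Set.mem_univ 0) ha (sub_nonneg.2 ha1)
    (add_sub_cancel a 1)
  simp only [smul_eq_mul, mul_zero, add_zero, Real.exp_zero, mul_one] at h
  have h1 : Real.exp (a * r) = Real.exp a * Real.exp (a * (r - 1)) := by
    rw [← Real.exp_add]; ring_nf
  have h2 : Real.exp (r - 1) = Real.exp (-1) * Real.exp r := by
    rw [← Real.exp_add]; ring_nf
  rw [h1, ← h2]
  exact mul_le_mul_of_nonneg_left h (Real.exp_pos a).le

lemma lintegral_exp_le_of_le [IsProbabilityMeasure P] {Y Q : Ω → ℝ} (hY : Integrable Y P) (hY0 : ∫ s, Y s ∂P = 0)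
    (hQm : AEMeasurable Q P)
    (hQ : ∫⁻ s, ENNReal.ofReal (Real.exp (Q s)) ∂P ≤ ENNReal.ofReal (Real.exp 1))
    {b K a : ℝ} (ha : 0 ≤ a) (hK : 0 ≤ K)
    (hle : ∀ s, Real.exp (Y s) ≤
      b * Y s + K * (a * (Real.exp (-1) * Real.exp (Q s)) + (1 - a))) :
    ∫⁻ s, ENNReal.ofReal (Real.exp (Y s)) ∂P ≤ ENNReal.ofReal K := by
  have hQi : Integrable (fun s => Real.exp (Q s)) P := by
    refine (lintegral_ofReal_ne_top_iff_integrable (Real.measurable_exp.comp_aemeasurable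
      hQm).aestronglyMeasurable (Filter.Eventually.of_forall fun s => (Real.exp_pos _).le)).1 ?_
    exact ne_top_of_le_ne_top ENNReal.ofReal_ne_top hQ
  have hQe : ∫ s, Real.exp (Q s) ∂P ≤ Real.exp 1 := by
    rw [← ofReal_integral_eq_lintegral_ofReal hQi
      (Filter.Eventually.of_forall fun s => (Real.exp_pos _).le)] at hQ
    exact (ENNReal.ofReal_le_ofReal_iff (Real.exp_pos _).le).1 hQ
  have hRi : Integrable (fun s => a * (Real.exp (-1) * Real.exp (Q s)) + (1 - a)) P :=
    ((hQi.const_mul _).const_mul _).add (integrable_const _)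
  have hBi : Integrable (fun s => b * Y s +
      K * (a * (Real.exp (-1) * Real.exp (Q s)) + (1 - a))) P :=
    (hY.const_mul b).add (hRi.const_mul K)
  refine (lintegral_mono fun s => ENNReal.ofReal_le_ofReal (hle s)).trans ?_
  rw [← ofReal_integral_eq_lintegral_ofReal hBi
    (Filter.Eventually.of_forall fun s => (Real.exp_pos _).le.trans (hle s))]
  refine ENNReal.ofReal_le_ofReal ?_
  rw [integral_add (hY.const_mul b) (hRi.const_mul K), integral_const_mul, integral_const_mul, hY0,
    mul_zero, zero_add, integral_add ((hQi.const_mul _).const_mul _) (integrable_const _),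
    integral_const_mul, integral_const_mul, integral_const, probReal_univ, one_smul]
  have h1 : Real.exp (-1) * ∫ s, Real.exp (Q s) ∂P ≤ 1 := by
    calc _ ≤ Real.exp (-1) * Real.exp 1 := mul_le_mul_of_nonneg_left hQe (Real.exp_pos _).le
      _ = 1 := by rw [← Real.exp_add]; simp
  nlinarith [mul_le_mul_of_nonneg_left h1 ha]

/-- A centred random variable dominated by `ν R` with `E exp(R²) ≤ e` is sub-Gaussian. -/
lemma lintegral_exp_le_of_light_tail [IsProbabilityMeasure P] {Y R : Ω → ℝ} {ν : ℝ} (hY : Integrable Y P)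
    (hY0 : ∫ s, Y s ∂P = 0) (hRm : AEMeasurable R P)
    (hR : ∫⁻ s, ENNReal.ofReal (Real.exp (R s ^ 2)) ∂P ≤ ENNReal.ofReal (Real.exp 1))
    (hYR : ∀ s, |Y s| ≤ ν * R s) :
    ∫⁻ s, ENNReal.ofReal (Real.exp (Y s)) ∂P ≤ ENNReal.ofReal (Real.exp (3 / 4 * ν ^ 2)) := by
  have hsq : ∀ s, Y s ^ 2 ≤ ν ^ 2 * R s ^ 2 := fun s => by
    rw [← mul_pow, ← sq_abs (Y s)]
    exact pow_le_pow_left₀ (abs_nonneg _) (hYR s) 2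
  -- For `ν² ≤ 16/9` the weight `9ν²/16` is at most `1`. Otherwise `ν R ≤ 3ν²/8 + 2R²/3`, and `3ν²/8
  -- + 2/3 ≤ 3ν²/4` holds exactly when `ν² ≥ 16/9`.
  rcases le_total (ν ^ 2) (16 / 9) with hν | hν
  · refine (lintegral_exp_le_of_le hY hY0 (hRm.pow_const 2) hR (b := 1)
      (K := Real.exp (9 / 16 * ν ^ 2)) (a := 9 / 16 * ν ^ 2) (by positivity) (Real.exp_pos _).le
      fun s => ?_).trans (ENNReal.ofReal_le_ofReal (Real.exp_le_exp.2 (by nlinarith [sq_nonneg ν])))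
    have h1 := exp_le_add_exp_sq (Y s)
    have h2 := exp_mul_le (a := 9 / 16 * ν ^ 2) (by positivity) (by linarith) (R s ^ 2)
    have h3 : Real.exp (9 * Y s ^ 2 / 16) ≤ Real.exp (9 / 16 * ν ^ 2 * R s ^ 2) :=
      Real.exp_le_exp.2 (by linarith [hsq s])
    linarith
  · refine (lintegral_exp_le_of_le hY hY0 (hRm.pow_const 2) hR (b := 0)
      (K := Real.exp (3 / 8 * ν ^ 2) * Real.exp (2 / 3)) (a := 2 / 3) (by norm_num) (by positivity)
      fun s => ?_).trans (ENNReal.ofReal_le_ofReal ?_)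
    · have h2 := exp_mul_le (a := 2 / 3) (by norm_num) (by norm_num) (R s ^ 2)
      have h3 : Real.exp (Y s) ≤ Real.exp (3 / 8 * ν ^ 2) * Real.exp (2 / 3 * R s ^ 2) := by
        rw [← Real.exp_add]
        refine Real.exp_le_exp.2 ((le_abs_self _).trans ((hYR s).trans ?_))
        nlinarith [sq_nonneg (3 * ν - 4 * R s)]
      have h4 := mul_le_mul_of_nonneg_left h2 (Real.exp_pos (3 / 8 * ν ^ 2)).le
      rw [mul_assoc, zero_mul, zero_add]
      linarith
    · rw [← Real.exp_add]
      exact Real.exp_le_exp.2 (by linarith)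

/-! ### Integration over independent noise -/

lemma lintegral_comp_indep [IsProbabilityMeasure P] {E Ξ : Type*} [MeasurableSpace E]
    [MeasurableSpace Ξ] {W : Ω → E} {ξ : Ω → Ξ} (hW : Measurable W) (hξ : Measurable ξ) (h : IndepFun W ξ P)
    {F : E × Ξ → ENNReal} (hF : Measurable F) :
    ∫⁻ s, F (W s, ξ s) ∂P = ∫⁻ s, ∫⁻ s', F (W s, ξ s') ∂P ∂P := by
  have h1 := (indepFun_iff_map_prod_eq_prod_map_map hW.aemeasurable hξ.aemeasurable).1 h
  have : IsProbabilityMeasure (P.map ξ) := Measure.isProbabilityMeasure_map hξ.aemeasurable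
  rw [← lintegral_map (f := F) (g := fun s => (W s, ξ s)) hF (hW.prodMk hξ), h1,
    lintegral_prod _ hF.aemeasurable, lintegral_map hF.lintegral_prod_right' hW]
  refine lintegral_congr fun s => ?_
  exact lintegral_map (hF.comp measurable_prodMk_left) hξ

section Filtration

section NoiseAlg

variable {ι Ω' Ξ : Type*} [mΞ : MeasurableSpace Ξ] {ξ : ι → Ω' → Ξ}

/-- The σ-algebra generated by the noise with index in `S`. -/
@[reducible]
def noiseAlg (ξ : ι → Ω' → Ξ) (S : Set ι) : MeasurableSpace Ω' :=
  ⨆ q ∈ S, MeasurableSpace.comap (ξ q) mΞ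

lemma noiseAlg_mono {S S' : Set ι} (h : S ⊆ S') : noiseAlg ξ S ≤ noiseAlg ξ S' :=
  biSup_mono h

lemma noiseAlg_le [mΩ : MeasurableSpace Ω'] (hξ : ∀ q, Measurable (ξ q)) (S : Set ι) :
    noiseAlg ξ S ≤ mΩ :=
  iSup₂_le fun q _ => (hξ q).comap_le

lemma measurable_noiseAlg {S : Set ι} {q : ι} (hq : q ∈ S) : Measurable[noiseAlg ξ S] (ξ q) :=
  Measurable.of_comap_le (le_biSup (fun q => MeasurableSpace.comap (ξ q) mΞ) hq)

end NoiseAlg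

variable {ι E Ξ : Type*} [LinearOrder ι] [MeasurableSpace E] [MeasurableSpace Ξ]
  {ξ : ι → Ω → Ξ}

lemma indepFun_of_measurable_noiseAlg {E' : Type*} [MeasurableSpace E']
    (hξ : ∀ q, Measurable (ξ q)) (hind : iIndepFun ξ P) {q : ι} {W : Ω → E'}
    (hW : Measurable[noiseAlg ξ (Set.Iio q)] W) : IndepFun W (ξ q) P := by
  have h := indep_iSup_of_disjoint (fun q => (hξ q).comap_le) hind.iIndep
    (S := Set.Iio q) (T := {q}) (by simp)
  rw [IndepFun_iff_Indep]
  refine indep_of_indep_of_le_left (indep_of_indep_of_le_right h ?_) hW.comap_le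
  simp

/-- Exponential moments of a sum of conditionally sub-Gaussian terms. -/
lemma lintegral_exp_sum_le [IsProbabilityMeasure P] (hξ : ∀ q, Measurable (ξ q)) (hind : iIndepFun ξ P) {U : ι → Ω → E}
    {D : ι → E × Ξ → ℝ} {b : ι → ℝ} (A : Finset ι)
    (hU : ∀ q ∈ A, Measurable[noiseAlg ξ (Set.Iio q)] (U q)) (hD : ∀ q ∈ A, Measurable (D q))
    (hb : ∀ q ∈ A, ∀ s, ∫⁻ s', ENNReal.ofReal (Real.exp (D q (U q s, ξ q s'))) ∂P ≤
      ENNReal.ofReal (Real.exp (b q))) :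
    ∫⁻ s, ENNReal.ofReal (Real.exp (∑ q ∈ A, D q (U q s, ξ q s))) ∂P ≤
      ENNReal.ofReal (Real.exp (∑ q ∈ A, b q)) := by
  induction A using Finset.induction_on_max with
  | empty => simp
  | insert q A hlt ih =>
    have hqA : q ∉ A := fun h => (hlt q h).false
    have ih := ih (fun r hr => hU r (Finset.mem_insert_of_mem hr))
      (fun r hr => hD r (Finset.mem_insert_of_mem hr))
      (fun r hr => hb r (Finset.mem_insert_of_mem hr))
    have hUq := hU q (Finset.mem_insert_self q A)
    have hDq := hD q (Finset.mem_insert_self q A)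
    have hbq := hb q (Finset.mem_insert_self q A)
    -- With `q` the largest index, the remaining sum and `U q` are functions of noise before `q`,
    -- hence jointly independent of `ξ q`; integrating `ξ q` first costs the factor `exp (b q)`.
    have hS : Measurable[noiseAlg ξ (Set.Iio q)] (fun s => ∑ r ∈ A, D r (U r s, ξ r s)) := by
      refine Finset.measurable_fun_sum A fun r hr => ?_
      refine (hD r (Finset.mem_insert_of_mem hr)).comp (Measurable.prodMk ?_ ?_)
      · exact (hU r (Finset.mem_insert_of_mem hr)).mono
          (noiseAlg_mono (Set.Iio_subset_Iio (hlt r hr).le)) le_rfl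
      · exact measurable_noiseAlg (hlt r hr)
    have hW : Measurable[noiseAlg ξ (Set.Iio q)]
        (fun s => (∑ r ∈ A, D r (U r s, ξ r s), U q s)) := hS.prodMk hUq
    have hle := noiseAlg_le hξ (Set.Iio q)
    have hF : Measurable (fun w : (ℝ × E) × Ξ =>
        ENNReal.ofReal (Real.exp w.1.1) * ENNReal.ofReal (Real.exp (D q (w.1.2, w.2)))) := by
      have : Measurable (fun w : (ℝ × E) × Ξ => D q (w.1.2, w.2)) := hDq.comp (by fun_prop)
      fun_prop
    have h1 := lintegral_comp_indep (hW.mono hle le_rfl) (hξ q)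
      (indepFun_of_measurable_noiseAlg hξ hind hW) hF
    have h2 : ∀ s, ENNReal.ofReal (Real.exp (∑ r ∈ insert q A, D r (U r s, ξ r s))) =
        ENNReal.ofReal (Real.exp (∑ r ∈ A, D r (U r s, ξ r s))) *
          ENNReal.ofReal (Real.exp (D q (U q s, ξ q s))) := fun s => by
      rw [Finset.sum_insert hqA, add_comm, Real.exp_add, ENNReal.ofReal_mul (Real.exp_pos _).le]
    simp only [h2]
    rw [h1]
    calc _ ≤ ∫⁻ s, ENNReal.ofReal (Real.exp (∑ r ∈ A, D r (U r s, ξ r s))) *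
          ENNReal.ofReal (Real.exp (b q)) ∂P := by
          refine lintegral_mono fun s => ?_
          dsimp only
          rw [lintegral_const_mul' _ _ ENNReal.ofReal_ne_top]
          exact mul_le_mul_right (hbq s) _
      _ = (∫⁻ s, ENNReal.ofReal (Real.exp (∑ r ∈ A, D r (U r s, ξ r s))) ∂P) *
          ENNReal.ofReal (Real.exp (b q)) := lintegral_mul_const' _ _ ENNReal.ofReal_ne_top
      _ ≤ ENNReal.ofReal (Real.exp (∑ r ∈ A, b r)) * ENNReal.ofReal (Real.exp (b q)) :=
          mul_le_mul_left ih _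
      _ = _ := by
          rw [Finset.sum_insert hqA, add_comm (b q), Real.exp_add,
            ENNReal.ofReal_mul (Real.exp_pos _).le]

end Filtration

/-- Markov's inequality for an exponential moment. -/
lemma measure_le_of_lintegral_exp_le {Y : Ω → ℝ} (hY : AEMeasurable Y P) {b : ℝ}
    (h : ∫⁻ s, ENNReal.ofReal (Real.exp (Y s)) ∂P ≤ ENNReal.ofReal (Real.exp b)) (a : ℝ) :
    P {s | a ≤ Y s} ≤ ENNReal.ofReal (Real.exp (b - a)) := by
  have h1 := mul_meas_ge_le_lintegral₀ (μ := P) (f := fun s => ENNReal.ofReal (Real.exp (Y s)))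
    (Real.measurable_exp.comp_aemeasurable hY).ennreal_ofReal (ENNReal.ofReal (Real.exp a))
  have h2 : {s | ENNReal.ofReal (Real.exp a) ≤ ENNReal.ofReal (Real.exp (Y s))} =
      {s | a ≤ Y s} := by
    ext s
    simp [ENNReal.ofReal_le_ofReal_iff (Real.exp_pos _).le]
  rw [h2] at h1
  have h3 : ENNReal.ofReal (Real.exp a) ≠ 0 := by simp [Real.exp_pos]
  rw [Real.exp_sub, ENNReal.ofReal_div_of_pos (Real.exp_pos a),
    ENNReal.le_div_iff_mul_le (Or.inl h3) (Or.inl ENNReal.ofReal_ne_top), mul_comm]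
  exact h1.trans h

/-- An average of random variables with `E exp ≤ e` inherits this bound. -/
lemma lintegral_exp_average_le {ι : Type*} {A : Finset ι} {w : ι → ℝ} {Q : ι → Ω → ℝ}
    (hw : ∀ q ∈ A, 0 ≤ w q) (hw1 : ∑ q ∈ A, w q = 1) (hQm : ∀ q ∈ A, Measurable (Q q)) {K : ℝ}
    (hQ : ∀ q ∈ A, ∫⁻ s, ENNReal.ofReal (Real.exp (Q q s)) ∂P ≤ ENNReal.ofReal K) :
    ∫⁻ s, ENNReal.ofReal (Real.exp (∑ q ∈ A, w q * Q q s)) ∂P ≤ ENNReal.ofReal K := by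
  calc _ ≤ ∫⁻ s, ∑ q ∈ A, ENNReal.ofReal (w q) * ENNReal.ofReal (Real.exp (Q q s)) ∂P := by
        refine lintegral_mono fun s => ?_
        have h := convexOn_exp.map_sum_le (p := fun q => Q q s) hw hw1 fun _ _ => Set.mem_univ _
        simp only [smul_eq_mul] at h
        refine (ENNReal.ofReal_le_ofReal h).trans (le_of_eq ?_)
        rw [ENNReal.ofReal_sum_of_nonneg fun q hq => mul_nonneg (hw q hq) (Real.exp_pos _).le]
        exact Finset.sum_congr rfl fun q hq => ENNReal.ofReal_mul (hw q hq)
    _ = ∑ q ∈ A, ENNReal.ofReal (w q) * ∫⁻ s, ENNReal.ofReal (Real.exp (Q q s)) ∂P := by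
        rw [lintegral_finsetSum]
        · exact Finset.sum_congr rfl fun q _ => lintegral_const_mul' _ _ ENNReal.ofReal_ne_top
        · intro q hq
          have := hQm q hq
          fun_prop
    _ ≤ ∑ q ∈ A, ENNReal.ofReal (w q) * ENNReal.ofReal K :=
        Finset.sum_le_sum fun q hq => mul_le_mul_right (hQ q hq) _
    _ = ENNReal.ofReal K := by
        rw [← Finset.sum_mul, ← ENNReal.ofReal_sum_of_nonneg hw, hw1, ENNReal.ofReal_one, one_mul]

end Probability

/-! ### Measurability of the iterates -/

section Measurability

variable {m d : ℕ} {Ω Ξ : Type*}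

/-- The oracle calls `(k, t, i)`, ordered lexicographically. -/
abbrev CallIndex (m : ℕ) : Type := ℕ ×ₗ (ℕ ×ₗ Fin m)

/-- The call of agent `i` at inner index `t` of outer iteration `k`. -/
def callIndex (k t : ℕ) (i : Fin m) : CallIndex m := toLex (k, toLex (t, i))

/-- The noise as a family over the oracle calls. -/
def callNoise (ξ : Fin m → ℕ → ℕ → Ω → Ξ) (q : CallIndex m) : Ω → Ξ :=
  ξ (ofLex (ofLex q).2).2 (ofLex q).1 (ofLex (ofLex q).2).1

/-- The oracle calls before inner index `t` of outer iteration `k`. -/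
def pastCalls (m k t : ℕ) : Set (CallIndex m) :=
  {q | (ofLex q).1 < k ∨ (ofLex q).1 = k ∧ (ofLex (ofLex q).2).1 < t}

/-- The order of agents within one pair `(k, t)` is immaterial: the iterates at `(k, t)` use only
calls at smaller pairs, which precede `callIndex k t i` for every `i`. -/
lemma pastCalls_subset_Iio (k t : ℕ) (i : Fin m) :
    pastCalls m k t ⊆ Set.Iio (callIndex k t i) := by
  intro q hq
  rw [Set.mem_Iio, Prod.Lex.lt_iff]
  refine hq.imp id fun h => ⟨h.1, ?_⟩
  rw [Prod.Lex.lt_iff]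
  exact Or.inl h.2

lemma pastCalls_mono (k : ℕ) {t t' : ℕ} (h : t ≤ t') : pastCalls m k t ⊆ pastCalls m k t' :=
  fun _ hq => hq.imp id fun h' => ⟨h'.1, h'.2.trans_le h⟩

lemma pastCalls_subset_succ (k t : ℕ) : pastCalls m k t ⊆ pastCalls m (k + 1) 0 :=
  fun q hq => Or.inl (by rcases hq with h | h <;> omega)

lemma callIndex_mem_pastCalls (k t : ℕ) (i : Fin m) :
    callIndex k t i ∈ pastCalls m k (t + 1) :=
  Or.inr ⟨rfl, Nat.lt_succ_self t⟩

variable {p : Seminorm ℝ (Vec d)} {U : Set (Vec d)} {ω : Vec d → ℝ} {gradω : Vec d → Vec d}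

/-- The gradient is continuous only on `U`; its extension by `0` off the compact set `U` is Borel.
-/
lemma IsDistGen.measurable_grad_comp {mΩ : MeasurableSpace Ω} {ν : ℝ}
    (h : IsDistGen p U ν ω gradω) (hU : IsCompact U) {u : Ω → Vec d} (hu : Measurable u)
    (huU : ∀ s, u s ∈ U) : Measurable fun s => gradω (u s) := by
  classical
  have h1 : Measurable (U.piecewise gradω 0) :=
    h.continuous_grad.measurable_piecewise continuousOn_const hU.measurableSet
  have h2 : (fun s => gradω (u s)) = fun s => U.piecewise gradω 0 (u s) := by
    ext1 s
    rw [Set.piecewise_eq_of_mem _ _ _ (huU s)]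
  rw [h2]
  exact h1.comp hu

lemma measurable_subgradient_sum {mΩ : MeasurableSpace Ω} {w h x u : Ω → Vec d}
    (hw : Measurable w) (hh : Measurable h) (hx : Measurable x) (hu : Measurable u) (a b : ℝ) :
    Measurable fun s => w s + h s - a • x s - b • u s := by
  fun_prop

lemma measurable_add_smul {mΩ : MeasurableSpace Ω} {x y : Ω → Vec d}
    (hx : Measurable x) (hy : Measurable y) (a : ℝ) : Measurable fun s => x s + a • y s := by
  fun_prop

lemma measurable_weighted_sum {mΩ : MeasurableSpace Ω} {A : Finset ℕ} {u : ℕ → Ω → Vec d}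
    (hu : ∀ t ∈ A, Measurable (u t)) (b : ℝ) (a : ℕ → ℝ) :
    Measurable fun s => b • ∑ t ∈ A, a t • u t s :=
  (Finset.measurable_fun_sum A fun t ht => (hu t ht).fun_const_smul (a t)).fun_const_smul b

/-- Each iterate is `proxMap`, a continuous map, applied to data measurable in the current σ-algebra
plus one new oracle answer, so the filtration index rises by one per step. -/
lemma measurable_inner_iterate (hω : IsDistGen p U 1 ω gradω) (hU : Convex ℝ U)
    (hUc : IsCompact U) (hp : ∀ x, p x = 0 → x = 0) {T : ℕ} {η : ℝ} (hη : 0 < η) {lam β : ℕ → ℝ}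
    (hβ : ∀ t : ℕ, 1 ≤ t → β t = t / 2) {w x xout xhat : Ω → Vec d} {h u : Ω → ℕ → Vec d}
    (hr : ∀ s, IsCSRun U ω gradω T η lam β (w s) (x s) (h s) (u s) (xout s) (xhat s))
    (hxU : ∀ s, x s ∈ U) {𝒢 : ℕ → MeasurableSpace Ω} (h𝒢 : Monotone 𝒢)
    (hw : Measurable[𝒢 0] w) (hx : Measurable[𝒢 0] x)
    (hh : ∀ t < T, Measurable[𝒢 t] (fun s => u s t) → Measurable[𝒢 (t + 1)] fun s => h s t) :
    ∀ t ≤ T, Measurable[𝒢 t] fun s => u s t := by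
  intro t
  induction t with
  | zero =>
    intro _
    simpa only [(hr _).init] using hx
  | succ t ih =>
    intro ht
    have hu := ih (by omega)
    have huU : ∀ s, u s t ∈ U := fun s => by
      rcases Nat.eq_zero_or_pos t with rfl | h0
      · rw [(hr s).init]; exact hxU s
      · exact (hr s).mem t (Finset.mem_Icc.2 ⟨h0, by omega⟩)
    have ht1 : t + 1 ∈ Finset.Icc 1 T := Finset.mem_Icc.2 ⟨by omega, ht⟩
    have hκ : 0 < η * (1 + β (t + 1)) := by
      rw [hβ _ (by omega)]
      positivity
    have heq : ∀ s, u s (t + 1) = proxMap U ω (η * (1 + β (t + 1)))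
        (w s + h s t - η • gradω (x s) - (η * β (t + 1)) • gradω (u s t)) := fun s => by
      have hmin := (hr s).isMin _ ht1
      simp only [Nat.add_sub_cancel] at hmin
      exact hω.eq_proxMap hU hUc hp hκ ((hr s).mem _ ht1) hmin
    simp only [heq]
    rcases isEmpty_or_nonempty Ω with hΩ | ⟨⟨s0⟩⟩
    · exact @measurable_of_empty _ _ (𝒢 (t + 1)) _ _ _
    have hprox := (hω.continuous_proxMap hU hUc ⟨_, hxU s0⟩ hp hκ).measurable
    refine hprox.comp ?_
    have h0 : 𝒢 0 ≤ 𝒢 (t + 1) := h𝒢 (by omega)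
    have hgx := hω.measurable_grad_comp hUc hx hxU
    have hgu := hω.measurable_grad_comp hUc hu huU
    exact measurable_subgradient_sum (hw.mono h0 le_rfl) (hh t (by omega) hu)
      (hgx.mono h0 le_rfl) (hgu.mono (h𝒢 (Nat.le_succ t)) le_rfl) _ _

lemma measurable_lapOp_apply {mΩ : MeasurableSpace Ω} (G : SimpleGraph (Fin m))
    [DecidableRel G.Adj] {x : Ω → Stack m d} (hx : ∀ i, Measurable fun s => x s i) (i : Fin m) :
    Measurable fun s => lapOp d G (x s) i := by
  have h1 : ∀ s, lapOp d G (x s) i = ∑ j, G.lapMatrix ℝ i j • x s j := fun s => rfl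
  simp only [h1]
  exact Finset.measurable_fun_sum _ fun j _ => (hx j).fun_const_smul _

lemma measurable_extrapolation {mΩ : MeasurableSpace Ω} {x y w : Ω → Vec d}
    (hx : Measurable x) (hy : Measurable y) (hw : Measurable w) (a : ℝ) :
    Measurable fun s => a • (x s - y s) + w s := by
  fun_prop

end Measurability

section MeasurableRun

variable {m d : ℕ} {Ω Ξ : Type*} [MeasurableSpace Ξ]
  {G : SimpleGraph (Fin m)} [DecidableRel G.Adj] {X : Fin m → Set (Vec d)}
  {p : Fin m → Seminorm ℝ (Vec d)} {ω : Fin m → Vec d → ℝ} {gradω : Fin m → Vec d → Vec d}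
  {x0 y0 : Stack m d} {c : Params} {N : ℕ} {ℓ : ℝ} {Gor : Fin m → Vec d → Ξ → Vec d}
  {ξ : Fin m → ℕ → ℕ → Ω → Ξ} {z : Ω → Iterates m d}

lemma measurable_iterates (hXconv : ∀ i, Convex ℝ (X i)) (hXcomp : ∀ i, IsCompact (X i))
    (hp : ∀ i x, p i x = 0 → x = 0) (hω : ∀ i, IsDistGen (p i) (X i) 1 (ω i) (gradω i))
    (hG : ∀ i, Measurable (fun q : Vec d × Ξ => Gor i q.1 q.2)) (hc : c.Admissible ℓ N)
    (hx0 : ∀ i, x0 i ∈ X i)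
    (hz : ∀ s, IsSDCSRun G X ω gradω c N x0 y0 (fun i k t u => Gor i u (ξ i k t s)) (z s)) :
    ∀ n ≤ N, (∀ k ≤ n, ∀ i,
      Measurable[noiseAlg (callNoise ξ) (pastCalls m (n + 1) 0)] (fun s => (z s).x k i) ∧
      Measurable[noiseAlg (callNoise ξ) (pastCalls m (n + 1) 0)] (fun s => (z s).xhat k i) ∧
      Measurable[noiseAlg (callNoise ξ) (pastCalls m (n + 1) 0)] (fun s => (z s).y k i)) ∧
      (1 ≤ n → ∀ t ≤ c.T n, ∀ i,
        Measurable[noiseAlg (callNoise ξ) (pastCalls m n t)] (fun s => (z s).u n t i)) := by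
  intro n
  induction n with
  | zero =>
    refine fun _ => ⟨fun k hk i => ?_, fun h => absurd h (by omega)⟩
    obtain rfl : k = 0 := by omega
    simp only [(hz _).x_zero, (hz _).xhat_zero, (hz _).y_zero]
    exact ⟨measurable_const, measurable_const, measurable_const⟩
  | succ n ih =>
    intro hn
    obtain ⟨ih, -⟩ := ih (by omega)
    have hk1 : n + 1 ∈ Finset.Icc 1 N := Finset.mem_Icc.2 ⟨by omega, hn⟩
    have hxt : ∀ i, Measurable[noiseAlg (callNoise ξ) (pastCalls m (n + 1) 0)]
        (fun s => (z s).xt (n + 1) i) := by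
      intro i
      simp only [(hz _).predict _ hk1]
      exact measurable_extrapolation (ih n le_rfl i).2.1 (ih (n + 1 - 2) (by omega) i).1
        (ih n le_rfl i).1 _
    have hy : ∀ i, Measurable[noiseAlg (callNoise ξ) (pastCalls m (n + 1) 0)]
        (fun s => (z s).y (n + 1) i) := by
      intro i
      simp only [(hz _).dual _ hk1, (hz _).disagree _ hk1]
      exact measurable_add_smul (ih n le_rfl i).2.2 (measurable_lapOp_apply G hxt i) _
    have hw : ∀ i, Measurable[noiseAlg (callNoise ξ) (pastCalls m (n + 1) 0)]
        (fun s => (z s).w (n + 1) i) := by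
      intro i
      simp only [(hz _).dual_comm _ hk1]
      exact measurable_lapOp_apply G hy i
    have hu : ∀ i, ∀ t ≤ c.T (n + 1), Measurable[noiseAlg (callNoise ξ) (pastCalls m (n + 1) t)]
        (fun s => (z s).u (n + 1) t i) := by
      intro i
      refine measurable_inner_iterate (hω i) (hXconv i) (hXcomp i) (hp i) (hc.η_pos _ hk1)
        hc.β_eq (fun s => (hz s).slide _ hk1 i)
        (fun s => (hz s).x_mem hx0 hc.T_pos (by omega) i)
        (𝒢 := fun t => noiseAlg (callNoise ξ) (pastCalls m (n + 1) t))
        (fun t t' h => noiseAlg_mono (pastCalls_mono _ h)) (hw i) (ih n le_rfl i).1 ?_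
      intro t _ hut
      refine (hG i).comp (Measurable.prodMk ?_ ?_)
      · exact hut.mono (noiseAlg_mono (pastCalls_mono _ (Nat.le_succ t))) le_rfl
      · exact measurable_noiseAlg (callIndex_mem_pastCalls (n + 1) t i)
    refine ⟨fun k hk i => ?_, fun _ t ht i => hu i t ht⟩
    rcases hk.eq_or_lt with rfl | hlt
    · refine ⟨?_, ?_, (hy i).mono (noiseAlg_mono (pastCalls_subset_succ _ _)) le_rfl⟩
      · simp only [((hz _).slide _ hk1 i).out]
        exact (hu i _ le_rfl).mono (noiseAlg_mono (pastCalls_subset_succ _ _)) le_rfl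
      · simp only [((hz _).slide _ hk1 i).avg]
        exact measurable_weighted_sum (fun t ht => (hu i t (Finset.mem_Icc.1 ht).2).mono
          (noiseAlg_mono (pastCalls_subset_succ _ _)) le_rfl) _ _
    · obtain ⟨h1, h2, h3⟩ := ih k (by omega) i
      have hle : noiseAlg (callNoise ξ) (pastCalls m (n + 1) 0) ≤
          noiseAlg (callNoise ξ) (pastCalls m (n + 1 + 1) 0) :=
        noiseAlg_mono (pastCalls_subset_succ _ _)
      exact ⟨h1.mono hle le_rfl, h2.mono hle le_rfl, h3.mono hle le_rfl⟩

end MeasurableRun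

/-! ### Tail bounds for the error terms -/

section Tails

variable {m d : ℕ} {Ω Ξ : Type*} [MeasurableSpace Ω] [MeasurableSpace Ξ] {P : Measure Ω}

lemma callIndex_injective :
    Function.Injective fun q : (_ : ℕ) × ℕ × Fin m => callIndex q.1 q.2.1 q.2.2 := by
  rintro ⟨k, t, i⟩ ⟨k', t', i'⟩ h
  simpa [callIndex] using h

/-- The oracle calls of a run of length `N`. -/
def allCalls (m : ℕ) (c : Params) (N : ℕ) : Finset (CallIndex m) :=
  ((Finset.Icc 1 N).sigma fun k => Finset.range (c.T k) ×ˢ Finset.univ).map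
    ⟨fun q : (_ : ℕ) × ℕ × Fin m => callIndex q.1 q.2.1 q.2.2, callIndex_injective⟩

lemma mem_allCalls {c : Params} {N : ℕ} {q : CallIndex m} (hq : q ∈ allCalls m c N) :
    ∃ k ∈ Finset.Icc 1 N, ∃ t < c.T k, ∃ i, q = callIndex k t i := by
  obtain ⟨⟨k, t, i⟩, hmem, rfl⟩ := Finset.mem_map.1 hq
  simp only [Finset.mem_sigma, Finset.mem_product, Finset.mem_range, Finset.mem_univ,
    and_true] at hmem
  exact ⟨k, hmem.1, t, hmem.2, i, rfl⟩

/-- Step `t` of the inner loop uses the oracle call at index `t - 1`, hence the shift. -/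
lemma sum_allCalls (c : Params) (N : ℕ) (g : CallIndex m → ℝ) :
    ∑ q ∈ allCalls m c N, g q =
      ∑ k ∈ Finset.Icc 1 N, ∑ t ∈ Finset.Icc 1 (c.T k), ∑ i, g (callIndex k (t - 1) i) := by
  rw [allCalls, Finset.sum_map, Finset.sum_sigma]
  refine Finset.sum_congr rfl fun k _ => ?_
  rw [Finset.sum_product]
  simp only [Function.Embedding.coeFn_mk]
  generalize c.T k = T
  induction T with
  | zero => simp
  | succ T ih => rw [Finset.sum_range_succ, Finset.sum_Icc_succ_top (by omega), ih]; rfl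

/-- The expectation of the oracle's answer at `u`. -/
noncomputable def oracleMean (P : Measure Ω) (Gor : Fin m → Vec d → Ξ → Vec d)
    (ξ : Fin m → ℕ → ℕ → Ω → Ξ) (i : Fin m) (k t : ℕ) (u : Vec d) : Vec d :=
  ∫ s, Gor i u (ξ i k t s) ∂P

variable {X : Fin m → Set (Vec d)} {p : Fin m → Seminorm ℝ (Vec d)}
  {f' : Fin m → Vec d → Vec d} {σ : ℝ} {Gor : Fin m → Vec d → Ξ → Vec d}
  {ξ : Fin m → ℕ → ℕ → Ω → Ξ}

lemma IsStochOracle.measurable_oracleMean [IsProbabilityMeasure P]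
    (h : IsStochOracle P p X f' σ Gor ξ) (i : Fin m) (k t : ℕ) :
    Measurable (oracleMean P Gor ξ i k t) := by
  have h1 : Measurable (Function.uncurry fun (u : Vec d) s => Gor i u (ξ i k t s)) :=
    (h.measurable_oracle i).comp
      (measurable_fst.prodMk ((h.measurable_noise i k t).comp measurable_snd))
  exact h1.stronglyMeasurable.integral_prod_right.measurable

lemma IsStochOracle.measurable_error [IsProbabilityMeasure P]
    (h : IsStochOracle P p X f' σ Gor ξ) (i : Fin m) (k t : ℕ) :
    Measurable fun w : Vec d × Ξ => Gor i w.1 w.2 - oracleMean P Gor ξ i k t w.1 :=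
  (h.measurable_oracle i).sub ((h.measurable_oracleMean i k t).comp measurable_fst)

lemma IsStochOracle.measurable_oracle_comp
    (h : IsStochOracle P p X f' σ Gor ξ) (i : Fin m) (k t : ℕ) (u : Vec d) :
    Measurable fun s => Gor i u (ξ i k t s) :=
  (h.measurable_oracle i).comp (measurable_const.prodMk (h.measurable_noise i k t))

/-- The inner product is dominated by `(a σ p(v)) (‖δ‖_* / σ)`, so the light-tail lemma applies with
`ν = a σ p(v)`. -/
lemma IsStochOracle.lintegral_exp_inner_le [IsProbabilityMeasure P]
    (h : IsStochOracle P p X f' σ Gor ξ) (hσ : 0 < σ) (hp : ∀ i x, p i x = 0 → x = 0)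
    (i : Fin m) (k t : ℕ) {u : Vec d} (hu : u ∈ X i) {a : ℝ} (ha : 0 ≤ a) (v : Vec d) :
    ∫⁻ s, ENNReal.ofReal (Real.exp (a * ⟪Gor i u (ξ i k t s) - f' i u, v⟫)) ∂P ≤
      ENNReal.ofReal (Real.exp (3 / 4 * (a * σ * p i v) ^ 2)) := by
  have hi : Integrable (fun s => Gor i u (ξ i k t s) - f' i u) P :=
    (h.integrable i k t u hu).sub (integrable_const _)
  have h0 : ∫ s, (Gor i u (ξ i k t s) - f' i u) ∂P = 0 := by
    rw [integral_sub (h.integrable i k t u hu) (integrable_const _), h.unbiased i k t u hu,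
      integral_const, probReal_univ, one_smul, sub_self]
  refine lintegral_exp_le_of_light_tail
    (R := fun s => dualNorm (p i) (Gor i u (ξ i k t s) - f' i u) / σ) ?_ ?_ ?_ ?_ ?_
  · exact (hi.inner_const v).const_mul a
  · rw [integral_const_mul]
    have h1 : ∫ s, ⟪Gor i u (ξ i k t s) - f' i u, v⟫ ∂P = 0 := by
      simp only [real_inner_comm v]
      rw [integral_inner hi, h0, inner_zero_right]
    rw [h1, mul_zero]
  · have h1 := (continuous_dualNorm (hp i)).measurable.comp
      ((h.measurable_oracle_comp i k t u).sub_const (f' i u))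
    exact (h1.div_const σ).aemeasurable
  · simpa only [div_pow] using h.light_tail i k t u hu
  · intro s
    have h1 := abs_inner_le_dualNorm_mul (hp i) (Gor i u (ξ i k t s) - f' i u) v
    rw [abs_mul, abs_of_nonneg ha]
    refine (mul_le_mul_of_nonneg_left h1 ha).trans (le_of_eq ?_)
    field_simp

lemma IsStochOracle.iIndepFun_callNoise (h : IsStochOracle P p X f' σ Gor ξ) :
    iIndepFun (callNoise ξ) P := by
  refine h.indep.precomp (g := fun q : CallIndex m =>
    ((ofLex (ofLex q).2).2, (ofLex q).1, (ofLex (ofLex q).2).1)) ?_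
  intro q q' hq
  simp only [Prod.mk.injEq] at hq
  refine ofLex_inj.1 (Prod.ext hq.2.1 (ofLex_inj.1 (Prod.ext hq.2.2 hq.1)))

variable {G : SimpleGraph (Fin m)} [DecidableRel G.Adj]
  {ω : Fin m → Vec d → ℝ} {gradω : Fin m → Vec d → Vec d} {xs x0 y0 : Stack m d}
  {c : Params} {N : ℕ} {ℓ : ℝ} {z : Ω → Iterates m d}

lemma sq_le_maxProx (hXconv : ∀ i, Convex ℝ (X i)) (hXcomp : ∀ i, IsCompact (X i))
    (hω : ∀ i, IsDistGen (p i) (X i) 1 (ω i) (gradω i)) (hxs : ∀ i, xs i ∈ X i) {i : Fin m}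
    {u : Vec d} (hu : u ∈ X i) :
    p i (xs i - u) ^ 2 ≤ 2 * sSup (prox (ω i) (gradω i) (xs i) '' X i) := by
  have h1 := (hω i).sq_le_prox (hXconv i) (hxs i) hu
  have h2 := le_csSup ((hω i).bddAbove_prox (hXcomp i) (xs i)) (Set.mem_image_of_mem _ hu)
  linarith

lemma sSup_prox_nonneg (hXconv : ∀ i, Convex ℝ (X i))
    (hω : ∀ i, IsDistGen (p i) (X i) 1 (ω i) (gradω i)) (hxs : ∀ i, xs i ∈ X i) (i : Fin m) :
    0 ≤ sSup (prox (ω i) (gradω i) (xs i) '' X i) := by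
  refine Real.sSup_nonneg ?_
  rintro _ ⟨u, hu, rfl⟩
  exact (hω i).prox_nonneg (hXconv i) (hxs i) hu

lemma measurable_inner_iterates (hXconv : ∀ i, Convex ℝ (X i)) (hXcomp : ∀ i, IsCompact (X i))
    (hp : ∀ i x, p i x = 0 → x = 0) (hω : ∀ i, IsDistGen (p i) (X i) 1 (ω i) (gradω i))
    (hSO : IsStochOracle P p X f' σ Gor ξ) (hc : c.Admissible ℓ N) (hx0 : ∀ i, x0 i ∈ X i)
    (hz : ∀ s, IsSDCSRun G X ω gradω c N x0 y0 (fun i k t u => Gor i u (ξ i k t s)) (z s))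
    {k t : ℕ} (hk : k ∈ Finset.Icc 1 N) (ht : t ≤ c.T k) (i : Fin m) :
    Measurable[noiseAlg (callNoise ξ) (Set.Iio (callIndex k t i))] (fun s => (z s).u k t i) := by
  obtain ⟨h1, h2⟩ := Finset.mem_Icc.1 hk
  exact ((measurable_iterates hXconv hXcomp hp hω hSO.measurable_oracle hc hx0 hz k h2).2 h1 t ht
    i).mono (noiseAlg_mono (pastCalls_subset_Iio k t i)) le_rfl

/-- The tail bound for the martingale part. -/
lemma measure_noiseLin_ge_le [IsProbabilityMeasure P] (hXconv : ∀ i, Convex ℝ (X i))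
    (hXcomp : ∀ i, IsCompact (X i))
    (hp : ∀ i x, p i x = 0 → x = 0) (hω : ∀ i, IsDistGen (p i) (X i) 1 (ω i) (gradω i))
    (hxs : ∀ i, xs i ∈ X i) (hσ : 0 < σ)
    (hSO : IsStochOracle P p X f' σ Gor ξ) (hc : c.Admissible ℓ N) (hx0 : ∀ i, x0 i ∈ X i)
    (hz : ∀ s, IsSDCSRun G X ω gradω c N x0 y0 (fun i k t u => Gor i u (ξ i k t s)) (z s))
    {ζ S : ℝ} (hζ : 0 < ζ) (hS : S = 2 * maxProx X ω gradω xs *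
      ∑ k ∈ Finset.Icc 1 N, ∑ t ∈ Finset.Icc 1 (c.T k),
        (c.θ k * c.lam t / ∑ s ∈ Finset.Icc 1 (c.T k), c.lam s) ^ 2) (hS0 : 0 < S) :
    P {s | ζ * (σ * Real.sqrt S) ≤
      noiseLin c N xs (fun i k t u => Gor i u (ξ i k t s)) f' (z s)} ≤
        ENNReal.ofReal (Real.exp (-ζ ^ 2 / 3)) := by
  have hB : 0 < σ * Real.sqrt S := mul_pos hσ (Real.sqrt_pos.2 hS0)
  set B := σ * Real.sqrt S with hBdef
  have hBsq : B ^ 2 = σ ^ 2 * S := by rw [hBdef, mul_pow, Real.sq_sqrt hS0.le]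
  -- This minimizes the Chernoff exponent `3/4 a² B² - a ζ B`, with minimum `-ζ² / 3`.
  set a : ℝ := 2 * ζ / (3 * B) with ha
  have ha0 : 0 < a := by positivity
  set co : ℕ → ℕ → ℝ := fun k t =>
    c.θ k * c.lam t / ∑ s ∈ Finset.Icc 1 (c.T k), c.lam s with hco
  have hco0 : ∀ k ∈ Finset.Icc 1 N, ∀ t, 0 ≤ co k (t + 1) := by
    intro k hk t
    have h1 := hc.sum_lam_pos (hc.T_pos k hk)
    have h2 := hc.θ_pos k hk
    simp only [hco]
    rw [hc.lam_eq (t + 1) (by omega)]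
    positivity
  set U : CallIndex m → Ω → Vec d := fun q s =>
    (z s).u (ofLex q).1 (ofLex (ofLex q).2).1 (ofLex (ofLex q).2).2 with hU
  set D : CallIndex m → Vec d × Ξ → ℝ := fun q w =>
    a * co (ofLex q).1 ((ofLex (ofLex q).2).1 + 1) *
      ⟪Gor (ofLex (ofLex q).2).2 w.1 w.2 -
        oracleMean P Gor ξ (ofLex (ofLex q).2).2 (ofLex q).1 (ofLex (ofLex q).2).1 w.1,
        xs (ofLex (ofLex q).2).2 - w.1⟫ with hD
  set b : CallIndex m → ℝ := fun q => 3 / 4 *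
    ((a * co (ofLex q).1 ((ofLex (ofLex q).2).1 + 1) * σ) ^ 2 *
      (2 * sSup (prox (ω (ofLex (ofLex q).2).2) (gradω (ofLex (ofLex q).2).2)
        (xs (ofLex (ofLex q).2).2) '' X (ofLex (ofLex q).2).2))) with hb
  have hξm : ∀ q, Measurable (callNoise ξ q) := fun q => hSO.measurable_noise _ _ _
  have huX : ∀ s, ∀ k ∈ Finset.Icc 1 N, ∀ t ≤ c.T k, ∀ i, (z s).u k t i ∈ X i :=
    fun s k hk t ht i => (hz s).u_mem hx0 hc.T_pos hk ht i
  have hDm : ∀ q, Measurable (D q) := by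
    intro q
    have h1 := hSO.measurable_error (ofLex (ofLex q).2).2 (ofLex q).1 (ofLex (ofLex q).2).1
    have h2 : Measurable fun w : Vec d × Ξ => xs (ofLex (ofLex q).2).2 - w.1 := by fun_prop
    exact (h1.inner h2).const_mul _
  have hUm : ∀ q ∈ allCalls m c N,
      Measurable[noiseAlg (callNoise ξ) (Set.Iio q)] (U q) := by
    intro q hq
    obtain ⟨k, hk, t, ht, i, rfl⟩ := mem_allCalls hq
    exact measurable_inner_iterates hXconv hXcomp hp hω hSO hc hx0 hz hk ht.le i
  have hmain := lintegral_exp_sum_le hξm hSO.iIndepFun_callNoise (U := U) (D := D) (b := b)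
    (allCalls m c N) hUm (fun q _ => hDm q) (by
      intro q hq s
      obtain ⟨k, hk, t, ht, i, rfl⟩ := mem_allCalls hq
      have hu := huX s k hk t ht.le i
      have h1 := hSO.lintegral_exp_inner_le hσ hp i k t hu
        (mul_nonneg ha0.le (hco0 k hk t)) (xs i - (z s).u k t i)
      rw [← hSO.unbiased i k t _ hu] at h1
      refine h1.trans (ENNReal.ofReal_le_ofReal (Real.exp_le_exp.2 ?_))
      have h2 := sq_le_maxProx hXconv hXcomp hω hxs hu
      rw [mul_pow _ (p i _)]
      exact mul_le_mul_of_nonneg_left (mul_le_mul_of_nonneg_left h2 (sq_nonneg _)) (by norm_num))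
  have hsum : ∀ s, ∑ q ∈ allCalls m c N, D q (U q s, callNoise ξ q s) =
      a * noiseLin c N xs (fun i k t u => Gor i u (ξ i k t s)) f' (z s) := by
    intro s
    rw [sum_allCalls, noiseLin, Finset.mul_sum]
    refine Finset.sum_congr rfl fun k hk => ?_
    rw [Finset.mul_sum]
    refine Finset.sum_congr rfl fun t ht => ?_
    rw [Finset.mul_sum]
    refine Finset.sum_congr rfl fun i _ => ?_
    obtain ⟨ht1, ht2⟩ := Finset.mem_Icc.1 ht
    have hu := huX s k hk (t - 1) (by omega) i
    have h1 : oracleMean P Gor ξ i k (t - 1) ((z s).u k (t - 1) i) =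
        f' i ((z s).u k (t - 1) i) := hSO.unbiased i k (t - 1) _ hu
    simp only [hD, hU, callIndex, ofLex_toLex, callNoise, h1, Nat.sub_add_cancel ht1, oracleError,
      hco]
    ring
  have hbsum : ∑ q ∈ allCalls m c N, b q = ζ ^ 2 / 3 := by
    have h1 : ∑ q ∈ allCalls m c N, b q = 3 / 4 * a ^ 2 * σ ^ 2 * S := by
      rw [sum_allCalls, hS, maxProx, ← mul_assoc, Finset.mul_sum]
      refine Finset.sum_congr rfl fun k hk => ?_
      rw [Finset.mul_sum]
      refine Finset.sum_congr rfl fun t ht => ?_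
      obtain ⟨ht1, ht2⟩ := Finset.mem_Icc.1 ht
      simp only [hb, callIndex, ofLex_toLex, Nat.sub_add_cancel ht1, hco]
      simp only [← Finset.mul_sum]
      ring
    rw [h1, mul_assoc, ← hBsq, ha]
    field_simp
    norm_num
  rw [hbsum] at hmain
  have hmeas : Measurable fun s => ∑ q ∈ allCalls m c N, D q (U q s, callNoise ξ q s) := by
    refine Finset.measurable_fun_sum _ fun q hq => (hDm q).comp (Measurable.prodMk ?_ (hξm q))
    exact (hUm q hq).mono (noiseAlg_le hξm _) le_rfl
  have htail := measure_le_of_lintegral_exp_le hmeas.aemeasurable hmain (a * (ζ * B))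
  have hexp : ζ ^ 2 / 3 - a * (ζ * B) = -ζ ^ 2 / 3 := by
    rw [ha]; field_simp; ring
  rw [hexp] at htail
  refine (measure_mono fun s hs => ?_).trans htail
  simp only [Set.mem_ofPred_eq] at hs ⊢
  rw [hsum]
  exact mul_le_mul_of_nonneg_left hs ha0.le

/-- The tail bound for the quadratic part. -/
lemma measure_noiseQuad_ge_le [IsProbabilityMeasure P] (hXconv : ∀ i, Convex ℝ (X i))
    (hXcomp : ∀ i, IsCompact (X i))
    (hp : ∀ i x, p i x = 0 → x = 0) (hω : ∀ i, IsDistGen (p i) (X i) 1 (ω i) (gradω i))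
    (hσ : 0 < σ)
    (hSO : IsStochOracle P p X f' σ Gor ξ) (hc : c.Admissible ℓ N) (hx0 : ∀ i, x0 i ∈ X i)
    (hz : ∀ s, IsSDCSRun G X ω gradω c N x0 y0 (fun i k t u => Gor i u (ξ i k t s)) (z s))
    (hS0 : 0 < quadBound m c N σ) (ζ : ℝ) :
    P {s | (1 + ζ) * quadBound m c N σ ≤
      noiseQuad p c N (fun i k t u => Gor i u (ξ i k t s)) f' (z s)} ≤
        ENNReal.ofReal (Real.exp (-ζ)) := by
  set S := quadBound m c N σ with hS
  -- Division by `quadBound` turns the coefficients into convex weights; Markov's inequality at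
  -- level `1 + ζ` then gives `exp (1 - (1 + ζ))`.
  set w : CallIndex m → ℝ := fun q => σ ^ 2 * c.θ (ofLex q).1 *
    c.lam ((ofLex (ofLex q).2).1 + 1) /
      ((∑ s ∈ Finset.Icc 1 (c.T (ofLex q).1), c.lam s) * c.η (ofLex q).1 *
        c.β ((ofLex (ofLex q).2).1 + 1)) / S with hw
  set F : CallIndex m → Vec d × Ξ → ℝ := fun q v =>
    dualNorm (p (ofLex (ofLex q).2).2) (Gor (ofLex (ofLex q).2).2 v.1 v.2 -
      oracleMean P Gor ξ (ofLex (ofLex q).2).2 (ofLex q).1 (ofLex (ofLex q).2).1 v.1) ^ 2 / σ ^ 2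
    with hF
  set U : CallIndex m → Ω → Vec d := fun q s =>
    (z s).u (ofLex q).1 (ofLex (ofLex q).2).1 (ofLex (ofLex q).2).2 with hU
  have hξm : ∀ q, Measurable (callNoise ξ q) := fun q => hSO.measurable_noise _ _ _
  have huX : ∀ s, ∀ k ∈ Finset.Icc 1 N, ∀ t ≤ c.T k, ∀ i, (z s).u k t i ∈ X i :=
    fun s k hk t ht i => (hz s).u_mem hx0 hc.T_pos hk ht i
  have hFm : ∀ q, Measurable (F q) := by
    intro q
    have h1 := (continuous_dualNorm (hp (ofLex (ofLex q).2).2)).measurable.comp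
      (hSO.measurable_error (ofLex (ofLex q).2).2 (ofLex q).1 (ofLex (ofLex q).2).1)
    exact (h1.pow_const 2).div_const _
  have hUm : ∀ q ∈ allCalls m c N,
      Measurable[noiseAlg (callNoise ξ) (Set.Iio q)] (U q) := by
    intro q hq
    obtain ⟨k, hk, t, ht, i, rfl⟩ := mem_allCalls hq
    exact measurable_inner_iterates hXconv hXcomp hp hω hSO hc hx0 hz hk ht.le i
  have hUm' : ∀ q ∈ allCalls m c N, Measurable (U q) := fun q hq =>
    (hUm q hq).mono (noiseAlg_le hξm _) le_rfl
  have hw0 : ∀ q ∈ allCalls m c N, 0 ≤ w q := by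
    intro q hq
    obtain ⟨k, hk, t, ht, i, rfl⟩ := mem_allCalls hq
    have h1 := hc.sum_lam_pos (hc.T_pos k hk)
    have h2 := hc.θ_pos k hk
    have h3 := hc.η_pos k hk
    simp only [hw, callIndex, ofLex_toLex]
    rw [hc.lam_eq (t + 1) (by omega), hc.β_eq (t + 1) (by omega)]
    positivity
  have hw1 : ∑ q ∈ allCalls m c N, w q = 1 := by
    rw [hw, ← Finset.sum_div, div_eq_one_iff_eq hS0.ne', sum_allCalls, hS, quadBound]
    refine Finset.sum_congr rfl fun k _ => Finset.sum_congr rfl fun t ht =>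
      Finset.sum_congr rfl fun i _ => ?_
    simp only [callIndex, ofLex_toLex, Nat.sub_add_cancel (Finset.mem_Icc.1 ht).1]
  have hQ : ∀ q ∈ allCalls m c N,
      ∫⁻ s, ENNReal.ofReal (Real.exp (F q (U q s, callNoise ξ q s))) ∂P ≤
        ENNReal.ofReal (Real.exp 1) := by
    intro q hq
    have hm : Measurable fun v => ENNReal.ofReal (Real.exp (F q v)) := by
      have := hFm q
      fun_prop
    -- The light-tail bound is for fixed points; independence lets the random iterate be frozen
    -- first.
    rw [lintegral_comp_indep (hUm' q hq) (hξm q)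
      (indepFun_of_measurable_noiseAlg hξm hSO.iIndepFun_callNoise (hUm q hq)) hm]
    obtain ⟨k, hk, t, ht, i, rfl⟩ := mem_allCalls hq
    calc _ ≤ ∫⁻ _s, ENNReal.ofReal (Real.exp 1) ∂P := by
          refine lintegral_mono fun s => ?_
          have hu := huX s k hk t ht.le i
          have h1 := hSO.light_tail i k t _ hu
          rw [← hSO.unbiased i k t _ hu] at h1
          exact h1
      _ = _ := by simp
  have hmain := lintegral_exp_average_le (P := P) hw0 hw1
    (Q := fun q s => F q (U q s, callNoise ξ q s))
    (fun q hq => (hFm q).comp ((hUm' q hq).prodMk (hξm q))) hQ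
  have hsum : ∀ s, ∑ q ∈ allCalls m c N, w q * F q (U q s, callNoise ξ q s) =
      noiseQuad p c N (fun i k t u => Gor i u (ξ i k t s)) f' (z s) / S := by
    intro s
    rw [sum_allCalls, noiseQuad, Finset.sum_div]
    refine Finset.sum_congr rfl fun k hk => ?_
    rw [Finset.sum_div]
    refine Finset.sum_congr rfl fun t ht => ?_
    rw [Finset.sum_div]
    refine Finset.sum_congr rfl fun i _ => ?_
    obtain ⟨ht1, ht2⟩ := Finset.mem_Icc.1 ht
    have hu := huX s k hk (t - 1) (by omega) i
    have h1 : oracleMean P Gor ξ i k (t - 1) ((z s).u k (t - 1) i) =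
        f' i ((z s).u k (t - 1) i) := hSO.unbiased i k (t - 1) _ hu
    simp only [hw, hF, hU, callIndex, ofLex_toLex, callNoise, h1, Nat.sub_add_cancel ht1,
      oracleError]
    field_simp
  have hmeas : Measurable fun s => ∑ q ∈ allCalls m c N, w q * F q (U q s, callNoise ξ q s) :=
    Finset.measurable_fun_sum _ fun q hq =>
      ((hFm q).comp ((hUm' q hq).prodMk (hξm q))).const_mul _
  have htail := measure_le_of_lintegral_exp_le hmeas.aemeasurable hmain (1 + ζ)
  rw [show 1 - (1 + ζ) = -ζ by ring] at htail
  refine (measure_mono fun s hs => ?_).trans htail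
  simp only [Set.mem_ofPred_eq] at hs ⊢
  rw [hsum, le_div_iff₀ hS0]
  exact hs

/-- The martingale part vanishes if its variance proxy does. -/
lemma noiseLin_eq_zero (hXconv : ∀ i, Convex ℝ (X i)) (hXcomp : ∀ i, IsCompact (X i))
    (hp : ∀ i x, p i x = 0 → x = 0) (hω : ∀ i, IsDistGen (p i) (X i) 1 (ω i) (gradω i))
    (hxs : ∀ i, xs i ∈ X i) (hc : c.Admissible ℓ N) (hx0 : ∀ i, x0 i ∈ X i)
    {H : Fin m → ℕ → ℕ → Vec d → Vec d} {z : Iterates m d}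
    (hz : IsSDCSRun G X ω gradω c N x0 y0 H z)
    (hS : 2 * maxProx X ω gradω xs *
      ∑ k ∈ Finset.Icc 1 N, ∑ t ∈ Finset.Icc 1 (c.T k),
        (c.θ k * c.lam t / ∑ s ∈ Finset.Icc 1 (c.T k), c.lam s) ^ 2 ≤ 0) :
    noiseLin c N xs H f' z = 0 := by
  refine Finset.sum_eq_zero fun k hk => Finset.sum_eq_zero fun t ht =>
    Finset.sum_eq_zero fun i _ => ?_
  obtain ⟨ht1, ht2⟩ := Finset.mem_Icc.1 ht
  have hu := hz.u_mem hx0 hc.T_pos hk (t := t - 1) (by omega) i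
  have hV : ∀ j ∈ Finset.univ, 0 ≤ sSup (prox (ω j) (gradω j) (xs j) '' X j) := fun j _ =>
    sSup_prox_nonneg hXconv hω hxs j
  have h1 : p i (xs i - z.u k (t - 1) i) ^ 2 ≤ 2 * maxProx X ω gradω xs :=
    (sq_le_maxProx hXconv hXcomp hω hxs hu).trans
      (mul_le_mul_of_nonneg_left (Finset.single_le_sum hV (Finset.mem_univ i)) zero_le_two)
  set co := c.θ k * c.lam t / ∑ s ∈ Finset.Icc 1 (c.T k), c.lam s with hco
  have h2 : co ^ 2 ≤ ∑ k ∈ Finset.Icc 1 N, ∑ t ∈ Finset.Icc 1 (c.T k),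
        (c.θ k * c.lam t / ∑ s ∈ Finset.Icc 1 (c.T k), c.lam s) ^ 2 :=
    (Finset.single_le_sum (f := fun t =>
      (c.θ k * c.lam t / ∑ s ∈ Finset.Icc 1 (c.T k), c.lam s) ^ 2)
      (fun _ _ => sq_nonneg _) ht).trans
    (Finset.single_le_sum (f := fun k => ∑ t ∈ Finset.Icc 1 (c.T k),
        (c.θ k * c.lam t / ∑ s ∈ Finset.Icc 1 (c.T k), c.lam s) ^ 2)
      (fun _ _ => Finset.sum_nonneg fun _ _ => sq_nonneg _) hk)
  have h3 : (p i (xs i - z.u k (t - 1) i) * co) ^ 2 ≤ 0 := by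
    rw [mul_pow]
    exact (mul_le_mul h1 h2 (sq_nonneg _) ((sq_nonneg _).trans h1)).trans hS
  have h4 := pow_eq_zero_iff two_ne_zero |>.1 (le_antisymm h3 (sq_nonneg _))
  rcases mul_eq_zero.1 h4 with h5 | h5
  · rw [hp i _ h5, inner_zero_right, mul_zero]
  · rw [h5, zero_mul]

lemma quadBound_pos (hm : 0 < m) (hN : 1 ≤ N) (hσ : 0 < σ) (hc : c.Admissible ℓ N) :
    0 < quadBound m c N σ := by
  refine Finset.sum_pos (fun k hk => Finset.sum_pos (fun t ht => Finset.sum_pos (fun i _ => ?_)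
    ⟨⟨0, hm⟩, Finset.mem_univ _⟩) ⟨1, Finset.mem_Icc.2 ⟨le_rfl, hc.T_pos k hk⟩⟩)
    ⟨1, Finset.mem_Icc.2 ⟨le_rfl, hN⟩⟩
  have ht1 := (Finset.mem_Icc.1 ht).1
  have ht0 : (0 : ℝ) < t := by exact_mod_cast ht1
  have h1 := hc.sum_lam_pos (hc.T_pos k hk)
  have h2 := hc.θ_pos k hk
  have h3 := hc.η_pos k hk
  rw [hc.lam_eq t ht1, hc.β_eq t ht1]
  positivity

end Tails

end SDCS

/-! ### The union bound -/

theorem mainTheorem6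
    {m d : ℕ} {Ω Ξ : Type*} [MeasurableSpace Ω] [MeasurableSpace Ξ]
    (P : Measure Ω) [IsProbabilityMeasure P]
    -- the connected network
    (G : SimpleGraph (Fin m)) [DecidableRel G.Adj] (hG : G.Connected)
    -- the constraint sets and their norms
    (X : Fin m → Set (SDCS.Vec d)) (hXconv : ∀ i, Convex ℝ (X i)) (hXcomp : ∀ i, IsCompact (X i))
    (p : Fin m → Seminorm ℝ (SDCS.Vec d)) (hp : ∀ i x, p i x = 0 → x = 0)
    -- the distance generating functions, with modulus 1
    (ω : Fin m → SDCS.Vec d → ℝ) (gradω : Fin m → SDCS.Vec d → SDCS.Vec d)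
    (hω : ∀ i, SDCS.IsDistGen (p i) (X i) 1 (ω i) (gradω i))
    -- the convex objectives and their subgradients
    (f : Fin m → SDCS.Vec d → ℝ) (f' : Fin m → SDCS.Vec d → SDCS.Vec d)
    (hf : ∀ i, ConvexOn ℝ (X i) (f i)) (M : ℝ) (hM : 0 < M)
    (hf' : ∀ i, ∀ x ∈ X i, ∀ y ∈ X i,
      0 ≤ f i x - f i y - ⟪f' i y, x - y⟫ ∧
        f i x - f i y - ⟪f' i y, x - y⟫ ≤ M * p i (x - y))
    -- an optimal solution
    (xs : SDCS.Stack m d) (hxs : xs ∈ SDCS.feasibleSet G X)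
    (hopt : IsMinOn (SDCS.objective f) (SDCS.feasibleSet G X) xs)
    -- the stochastic oracle
    (σ : ℝ) (hσ : 0 < σ) (Gor : Fin m → SDCS.Vec d → Ξ → SDCS.Vec d)
    (ξ : Fin m → ℕ → ℕ → Ω → Ξ) (hSO : SDCS.IsStochOracle P p X f' σ Gor ξ)
    -- the parameters, the starting point and the iterates
    (N : ℕ) (hN : 1 ≤ N) (c : SDCS.Params) (hc : c.Admissible (SDCS.lapNorm G p) N)
    (x0 y0 : SDCS.Stack m d) (hx0 : ∀ i, x0 i ∈ X i)
    (z : Ω → SDCS.Iterates m d)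
    (hz : ∀ s, SDCS.IsSDCSRun G X ω gradω c N x0 y0
      (fun i k t u => Gor i u (ξ i k t s)) (z s))
    (ζ : ℝ) (hζ : 0 < ζ) :
    P {s | ((SDCS.boundD c N M σ (SDCS.stackProx ω gradω x0 xs) y0 +
              ζ * SDCS.boundP m c N σ (SDCS.maxProx X ω gradω xs) : ℝ) : EReal) ≤
            SDCS.perturbedGap G f xs ((z s).vHat G c N) ((z s).xAvg c N) ((z s).yAvg c N)} ≤
      ENNReal.ofReal (Real.exp (-ζ ^ 2 / 3) + Real.exp (-ζ)) := by
  -- At least one agent is needed for `Q > 0`, by which the quadratic part is normalized.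
  have hm : 0 < m := Fin.pos_iff_nonempty.2 hG.nonempty
  set S := 2 * SDCS.maxProx X ω gradω xs *
      ∑ k ∈ Finset.Icc 1 N, ∑ t ∈ Finset.Icc 1 (c.T k),
        (c.θ k * c.lam t / ∑ s ∈ Finset.Icc 1 (c.T k), c.lam s) ^ 2 with hS
  set Q := SDCS.quadBound m c N σ with hQ
  have hQ0 : 0 < Q := SDCS.quadBound_pos hm hN hσ hc
  have hW := hc.sum_θ_pos hN
  set W := ∑ k ∈ Finset.Icc 1 N, c.θ k with hWdef
  have hBP : SDCS.boundP m c N σ (SDCS.maxProx X ω gradω xs) =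
      W⁻¹ * (σ * Real.sqrt S + Q) := rfl
  have hquad := SDCS.measure_noiseQuad_ge_le hXconv hXcomp hp hω hσ hSO hc hx0 hz hQ0 ζ
  have hevent : ∀ s, ((SDCS.boundD c N M σ (SDCS.stackProx ω gradω x0 xs) y0 +
              ζ * SDCS.boundP m c N σ (SDCS.maxProx X ω gradω xs) : ℝ) : EReal) ≤
            SDCS.perturbedGap G f xs ((z s).vHat G c N) ((z s).xAvg c N) ((z s).yAvg c N) →
      ζ * (σ * Real.sqrt S) + (1 + ζ) * Q ≤
        SDCS.noiseLin c N xs (fun i k t u => Gor i u (ξ i k t s)) f' (z s) +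
          SDCS.noiseQuad p c N (fun i k t u => Gor i u (ξ i k t s)) f' (z s) := by
    intro s hs
    have h1 := EReal.coe_le_coe_iff.1
      (hs.trans ((hz s).perturbedGap_le hXconv hp hω hf hf' hxs hN hc hx0 σ))
    rw [hBP, add_le_add_iff_left, ← mul_assoc, mul_comm ζ, mul_assoc] at h1
    have h2 := le_of_mul_le_mul_left h1 (inv_pos.2 hW)
    linarith
  rw [ENNReal.ofReal_add (Real.exp_pos _).le (Real.exp_pos _).le]
  -- When the variance proxy `S` vanishes the Chernoff parameter is undefined, but then `noiseLin`
  -- is identically zero and the quadratic tail alone suffices.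
  rcases lt_or_ge 0 S with hS0 | hS0
  · have hlin := SDCS.measure_noiseLin_ge_le hXconv hXcomp hp hω hxs.2 hσ hSO hc hx0 hz hζ hS hS0
    refine ((measure_mono fun s hs => ?_).trans (measure_union_le _ _)).trans
      (add_le_add hlin hquad)
    have h1 := hevent s hs
    simp only [Set.mem_union, Set.mem_ofPred_eq]
    by_contra hcon
    rw [not_or, not_le, not_le] at hcon
    linarith [hcon.1, hcon.2]
  · refine ((measure_mono fun s hs => ?_).trans hquad).trans le_add_self
    have h1 := hevent s hs
    rw [SDCS.noiseLin_eq_zero hXconv hXcomp hp hω hxs.2 hc hx0 (hz s) hS0,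
      Real.sqrt_eq_zero_of_nonpos hS0] at h1
    simp only [Set.mem_ofPred_eq]
    linarith
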